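/- Let $d\ge 2$ and let $q=(q_1,\dots,q_d)$ be a vector of positive integers. Call $V:\mathbb Z^d\to\mathbb R$ $q$-periodic if $V(n+q_i b_i)=V(n)$ for all $n\in\mathbb Z^d$ and $1\le i\le d$, where $b_1,\dots,b_d$ is the standard basis. For such $V$ let $H_V=\Delta+V$ be the bounded operator on $\ell^2(\mathbb Z^d)$ (complex-valued sequences) given by $$(H_Vu)(n)=\sum_{|m-n|=1}u(m)+V(n)u(n),\qquad |m-n|=\sum_{i=1}^d|m_i-n_i|.$$ Then there is a constant $c_q>0$, depending only on $d$ and $q$, such that for every $q$-periodic $V$ with $\|V\|_\infty=\sup_n|V(n)|\le c_q$: 1. the spectrum of $H_V$ is the union of at most two compact real intervals of positive length, that is, $\sigma(H_V)=[a_1,b_1]\cup[a_2,b_2]$ for some $a_1<b_1$ and $a_2<b_2$ (the two intervals may overlap or coincide); 2. if at least one $q_i$ is odd, the spectrum of $H_V$ is a single compact interval $[a,b]$ with $a<b$. -/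

import Mathlib

open scoped ENNReal

noncomputable section

/-- The lattice `ℤ^d`. -/
abbrev IntLattice (d : ℕ) : Type := Fin d → ℤ

/-- The Hilbert space `ℓ²(ℤ^d)` of complex-valued square-summable functions. -/
abbrev EllTwo (d : ℕ) : Type := lp (fun _ : IntLattice d => ℂ) 2

/-- Bounded real potentials on `ℤ^d`; the norm `‖V‖` is the supremum norm. -/
abbrev Potential (d : ℕ) : Type := lp (fun _ : IntLattice d => ℝ) ∞

/-- `V(n + q_i b_i) = V(n)` for every `n` and `i`, with `b_i` the standard basis. -/
def IsPeriodicWith {d : ℕ} (q : Fin d → ℕ) (V : Potential d) : Prop :=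
  ∀ (i : Fin d) (n : IntLattice d), V (n + Pi.single i (q i : ℤ)) = V n

/-- Translation by the lattice vector `v` on `ℓ²(ℤ^d)`: `(T_v u)(n) = u(n + v)`. -/
def translation {d : ℕ} (v : IntLattice d) : EllTwo d →L[ℂ] EllTwo d :=
  LinearMap.mkContinuous
    { toFun := fun u => ⟨fun n => u (n + v), by
        have h := (lp.memℓp u).summable (by norm_num)
        exact memℓp_gen ((Equiv.addRight v).summable_iff.2 h)⟩
      map_add' := fun _ _ => by ext; rfl
      map_smul' := fun _ _ => by ext; simp }
    1
    (fun u => by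
      rw [one_mul]
      refine lp.norm_le_of_tsum_le (by norm_num) (norm_nonneg u) ?_
      rw [lp.norm_rpow_eq_tsum (by norm_num) u]
      exact ((Equiv.addRight v).tsum_eq
        (fun n => ‖u n‖ ^ (2 : ℝ≥0∞).toReal)).le)

@[simp]
theorem translation_apply {d : ℕ} (v : IntLattice d) (u : EllTwo d) (n : IntLattice d) :
    translation v u n = u (n + v) := rfl

/-- The discrete Laplacian: the sum of the values at the `2d` nearest neighbours `n ± b_i`, which
are the lattice points at `ℓ¹` distance one from `n`. -/
def latticeLaplacian (d : ℕ) : EllTwo d →L[ℂ] EllTwo d :=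
  ∑ i : Fin d, (translation (Pi.single i 1) + translation (-Pi.single i 1))

/-- Multiplication by the potential `V` on `ℓ²(ℤ^d)`. -/
def multiplication {d : ℕ} (V : Potential d) : EllTwo d →L[ℂ] EllTwo d :=
  lp.mapCLM 2 (fun n => ((V n : ℝ) : ℂ) • ContinuousLinearMap.id ℂ ℂ) (norm_nonneg V)
    (fun n => by
      simpa [norm_smul] using lp.norm_apply_le_norm ENNReal.top_ne_zero V n)

/-- The discrete Schrödinger operator `H_V = Δ + V`. -/
def schrodinger {d : ℕ} (V : Potential d) : EllTwo d →L[ℂ] EllTwo d :=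
  latticeLaplacian d + multiplication V

theorem schrodinger_apply {d : ℕ} (V : Potential d) (u : EllTwo d) (n : IntLattice d) :
    schrodinger V u n =
      (∑ i : Fin d, (u (n + Pi.single i 1) + u (n - Pi.single i 1))) + (V n : ℂ) * u n := by
  let ev : EllTwo d →L[ℂ] ℂ := lp.evalCLM ℂ (fun _ : IntLattice d => ℂ) 2 n
  have h : ev (latticeLaplacian d u) =
      ∑ i : Fin d, (u (n + Pi.single i 1) + u (n - Pi.single i 1)) := by
    simp only [latticeLaplacian, sum_apply, map_sum, sub_eq_add_neg]
    rfl
  change ev (latticeLaplacian d u) + (V n : ℂ) * u n = _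
  rw [h]

end

/-! A `q`-periodic potential is a function on the finite group G = ∏ ℤ/q_i. Bloch–Floquet theory
replaces H_V by symmetric matrices on ℂ^G indexed by a quasimomentum θ, and σ(H_V) is the union of
the ranges of their ordered eigenvalues, the bands (`spectrum_schrodinger`). Bands are compact
intervals, and by Weyl's inequality V moves them by at most ‖V‖. Hence two consecutive bands that
overlap in more than a point for V = 0 still overlap for small V, and only the free bands need
study.

For V = 0 the characters of G diagonalise the fibre; the eigenvalues are the symbols ∑ 2 cos(θ_i +
a_i), with a the phases of a character. A level E separates two consecutive bands only if no ordered
eigenvalue passes from below E to above E. `Crosses` detects such a passage by counting symbols, so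
the sorting never has to be followed. To produce it, take a point where the symbol of the trivial
character equals E and leave it in two directions, so that the symbols going below in one and above
in the other number more than |G| in total.

For 0 < |E| < 2d the diagonal direction serves: there a symbol at level E with zero slope is E cos t
(`crosses_of_pos`). At E = 0 this degenerates. If some q_j is odd, no character has phase π along j,
and the j-th coordinate direction takes over (`crosses_zero_of_three_le`, `crosses_zero_of_two`). So
free bands can fail to overlap only at level 0 (`eq_zero_of_free_gap`), and for only one consecutive
pair, since no free band is constant (`exists_bands_union`). -/

open scoped ENNReal Topology InnerProductSpace
open Filter

set_option linter.unusedSectionVars false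

noncomputable section

/-! ### Symbols of the free Laplacian along rays -/

/-- The symbol `x ↦ ∑ 2 cos (x_i + a_i)` of the discrete Laplacian, with phases shifted by `a`. -/
def shiftedSymbol {d : ℕ} (a x : Fin d → ℝ) : ℝ := ∑ i, 2 * Real.cos (x i + a i)

/-- The derivative of `shiftedSymbol a` at `x` in the direction `β`. -/
def symbolSlope {d : ℕ} (a x β : Fin d → ℝ) : ℝ := -∑ i, 2 * Real.sin (x i + a i) * β i

/-- The symbol is below `E` just after leaving `x` in the direction `β`. -/
def GoesBelow {d : ℕ} (a x β : Fin d → ℝ) (E : ℝ) : Prop :=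
  ∀ᶠ t in 𝓝[>] (0 : ℝ), shiftedSymbol a (x + t • β) < E

/-- The symbol is above `E` just after leaving `x` in the direction `β`. -/
def GoesAbove {d : ℕ} (a x β : Fin d → ℝ) (E : ℝ) : Prop :=
  ∀ᶠ t in 𝓝[>] (0 : ℝ), E < shiftedSymbol a (x + t • β)

/-- Some sorted value of the family of symbols `shiftedSymbol (a l)` crosses the level `E`. -/
def Crosses {d : ℕ} {L : Type*} (a : L → Fin d → ℝ) (E : ℝ) : Prop :=
  ∃ y y' : Fin d → ℝ,
    {l | shiftedSymbol (a l) y' ≤ E}.ncard < {l | shiftedSymbol (a l) y < E}.ncard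

section symbol

variable {d : ℕ}

theorem hasDerivAt_shiftedSymbol (a x β : Fin d → ℝ) :
    HasDerivAt (fun t : ℝ => shiftedSymbol a (x + t • β)) (symbolSlope a x β) 0 := by
  have h : ∀ i ∈ Finset.univ, HasDerivAt (fun t : ℝ => 2 * Real.cos ((x + t • β) i + a i))
      (2 * (-Real.sin ((x + (0 : ℝ) • β) i + a i) * (1 * β i))) 0 := by
    intro i _
    simp only [Pi.add_apply, Pi.smul_apply, smul_eq_mul]
    exact (((((hasDerivAt_id (0 : ℝ)).mul_const (β i)).const_add (x i)).add_const (a i)).cos).const_mul 2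
  have := HasDerivAt.fun_sum h
  convert! this using 1
  simp [symbolSlope, mul_assoc]

theorem continuousAt_shiftedSymbol (a x β : Fin d → ℝ) :
    ContinuousAt (fun t : ℝ => shiftedSymbol a (x + t • β)) 0 :=
  (hasDerivAt_shiftedSymbol a x β).continuousAt

theorem goesBelow_of_lt {a x : Fin d → ℝ} (β : Fin d → ℝ) {E : ℝ} (h : shiftedSymbol a x < E) :
    GoesBelow a x β E :=
  ((continuousAt_shiftedSymbol a x β).eventually_lt_const (by simpa using h)).filter_mono
    nhdsWithin_le_nhds

theorem goesAbove_of_lt {a x : Fin d → ℝ} (β : Fin d → ℝ) {E : ℝ} (h : E < shiftedSymbol a x) :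
    GoesAbove a x β E :=
  ((continuousAt_shiftedSymbol a x β).eventually_const_lt (by simpa using h)).filter_mono
    nhdsWithin_le_nhds

theorem goesBelow_of_slope_neg {a x β : Fin d → ℝ} {E : ℝ} (h : shiftedSymbol a x = E)
    (hs : symbolSlope a x β < 0) : GoesBelow a x β E := by
  have := (hasDerivAt_shiftedSymbol a x β).tendsto_slope_zero_right.eventually_lt_const hs
  filter_upwards [this, self_mem_nhdsWithin] with t ht ht0
  rw [zero_add, zero_smul, add_zero, h, smul_eq_mul] at ht
  have h0 : (0 : ℝ) < t := ht0
  by_contra! hc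
  exact absurd ht (not_lt.2 (mul_nonneg (inv_nonneg.2 h0.le) (sub_nonneg.2 hc)))

theorem goesAbove_of_slope_pos {a x β : Fin d → ℝ} {E : ℝ} (h : shiftedSymbol a x = E)
    (hs : 0 < symbolSlope a x β) : GoesAbove a x β E := by
  have := (hasDerivAt_shiftedSymbol a x β).tendsto_slope_zero_right.eventually_const_lt hs
  filter_upwards [this, self_mem_nhdsWithin] with t ht ht0
  rw [zero_add, zero_smul, add_zero, h, smul_eq_mul] at ht
  have h0 : (0 : ℝ) < t := ht0
  by_contra! hc
  exact absurd ht (not_lt.2 (mul_nonpos_of_nonneg_of_nonpos (inv_nonneg.2 h0.le)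
    (sub_nonpos.2 hc)))

theorem symbolSlope_add_smul (a x β γ : Fin d → ℝ) (δ : ℝ) :
    symbolSlope a x (β + δ • γ) = symbolSlope a x β + δ * symbolSlope a x γ := by
  simp only [symbolSlope, Pi.add_apply, Pi.smul_apply, smul_eq_mul, mul_add, Finset.sum_add_distrib,
    neg_add, mul_neg, Finset.mul_sum]
  congr 2
  exact Finset.sum_congr rfl fun i _ => by ring

theorem symbolSlope_single (a x : Fin d → ℝ) (i : Fin d) :
    symbolSlope a x (Pi.single i 1) = -(2 * Real.sin (x i + a i)) := by
  simp [symbolSlope, Pi.single_apply]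

theorem shiftedSymbol_add_single (a x : Fin d → ℝ) (i : Fin d) (t : ℝ) :
    shiftedSymbol a (x + t • Pi.single i 1) =
      shiftedSymbol a x + 2 * (Real.cos (x i + a i + t) - Real.cos (x i + a i)) := by
  rw [← sub_eq_iff_eq_add', shiftedSymbol, shiftedSymbol, ← Finset.sum_sub_distrib,
    Finset.sum_eq_single i]
  · simp only [Pi.add_apply, Pi.smul_apply, Pi.single_eq_same, smul_eq_mul, mul_one]
    rw [add_right_comm]; ring
  · intro j _ hj
    simp [hj]
  · simp

theorem cos_lt_one_eventually : ∀ᶠ t in 𝓝[>] (0 : ℝ), Real.cos t < 1 := by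
  filter_upwards [Ioo_mem_nhdsGT Real.pi_pos] with t ht
  rw [← Real.cos_zero]
  exact Real.cos_lt_cos_of_nonneg_of_le_pi le_rfl ht.2.le ht.1

theorem goesBelow_single_of_cos_eq_one {a x : Fin d → ℝ} {E : ℝ} {i : Fin d}
    (h : shiftedSymbol a x = E) (hc : Real.cos (x i + a i) = 1) {s : ℝ} (hs : s = 1 ∨ s = -1) :
    GoesBelow a x (s • Pi.single i 1) E := by
  filter_upwards [cos_lt_one_eventually] with t ht
  have hsin : Real.sin (x i + a i) = 0 := by
    have := Real.sin_sq_add_cos_sq (x i + a i); rw [hc] at this; nlinarith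
  rw [smul_smul, shiftedSymbol_add_single, h, Real.cos_add, hc, hsin]
  rcases hs with rfl | rfl <;> simp <;> linarith

theorem goesAbove_single_of_cos_eq_neg_one {a x : Fin d → ℝ} {E : ℝ} {i : Fin d}
    (h : shiftedSymbol a x = E) (hc : Real.cos (x i + a i) = -1) {s : ℝ} (hs : s = 1 ∨ s = -1) :
    GoesAbove a x (s • Pi.single i 1) E := by
  filter_upwards [cos_lt_one_eventually] with t ht
  have hsin : Real.sin (x i + a i) = 0 := by
    have := Real.sin_sq_add_cos_sq (x i + a i); rw [hc] at this; nlinarith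
  rw [smul_smul, shiftedSymbol_add_single, h, Real.cos_add, hc, hsin]
  rcases hs with rfl | rfl <;> simp <;> linarith

/-- Along the diagonal direction the symbol is a multiple of a single cosine wave. -/
theorem shiftedSymbol_add_smul_one (a x : Fin d → ℝ) (t : ℝ) :
    shiftedSymbol a (x + t • 1) =
      shiftedSymbol a x * Real.cos t + symbolSlope a x 1 * Real.sin t := by
  simp only [shiftedSymbol, symbolSlope, Pi.add_apply, Pi.smul_apply, Pi.one_apply, smul_eq_mul,
    mul_one, neg_mul, Finset.sum_mul, ← sub_eq_add_neg, ← Finset.sum_sub_distrib]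
  refine Finset.sum_congr rfl fun i _ => ?_
  rw [add_right_comm, Real.cos_add]; ring

/-- With zero slope the restriction to the diagonal is E cos t, which drops at once because E > 0.
This is the step that is lost at E = 0. -/
theorem goesBelow_one_of_slope_eq_zero {a x : Fin d → ℝ} {E : ℝ} (hE : 0 < E)
    (h : shiftedSymbol a x = E) (hs : symbolSlope a x 1 = 0) : GoesBelow a x 1 E := by
  filter_upwards [cos_lt_one_eventually] with t ht
  rw [shiftedSymbol_add_smul_one, h, hs]
  nlinarith

theorem shiftedSymbol_add_pi (a x : Fin d → ℝ) :
    shiftedSymbol a (x + fun _ => Real.pi) = -shiftedSymbol a x := by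
  simp only [shiftedSymbol, ← Finset.sum_neg_distrib, Pi.add_apply]
  refine Finset.sum_congr rfl fun i _ => ?_
  rw [add_right_comm, Real.cos_add_pi]; ring

end symbol

/-! ### Level crossings by counting -/

section crossing

variable {d : ℕ} {L : Type*} [Finite L]

/-- At a common small time t, the symbols at most E on the second ray lie among those that do not go
above, hence are fewer than those strictly below E on the first. -/
theorem crosses_of_card_lt (a : L → Fin d → ℝ) {E : ℝ} {x β x' β' : Fin d → ℝ}
    (h : Nat.card L <
      {l | GoesBelow (a l) x β E}.ncard + {l | GoesAbove (a l) x' β' E}.ncard) :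
    Crosses a E := by
  have h1 : ∀ᶠ t in 𝓝[>] (0 : ℝ), ∀ l, GoesBelow (a l) x β E →
      shiftedSymbol (a l) (x + t • β) < E := by
    rw [eventually_all]; intro l
    by_cases hl : GoesBelow (a l) x β E
    · filter_upwards [hl] with t ht _ using ht
    · exact Eventually.of_forall fun t ht => absurd ht hl
  have h2 : ∀ᶠ t in 𝓝[>] (0 : ℝ), ∀ l, GoesAbove (a l) x' β' E →
      E < shiftedSymbol (a l) (x' + t • β') := by
    rw [eventually_all]; intro l
    by_cases hl : GoesAbove (a l) x' β' E
    · filter_upwards [hl] with t ht _ using ht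
    · exact Eventually.of_forall fun t ht => absurd ht hl
  obtain ⟨t, ht1, ht2⟩ := (h1.and h2).exists
  refine ⟨x + t • β, x' + t • β', ?_⟩
  have e1 : {l | GoesBelow (a l) x β E}.ncard ≤
      {l | shiftedSymbol (a l) (x + t • β) < E}.ncard :=
    Set.ncard_le_ncard fun l hl => ht1 l hl
  have e2 : {l | shiftedSymbol (a l) (x' + t • β') ≤ E}.ncard ≤
      {l | GoesAbove (a l) x' β' E}ᶜ.ncard :=
    Set.ncard_le_ncard fun l hl hc => absurd (ht2 l hc) (not_lt.2 hl)
  have e3 := Set.ncard_add_ncard_compl {l | GoesAbove (a l) x' β' E}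
  omega

/-- Along β every symbol goes below E except those above E or at E with positive slope; these go
above along β, and still do after a small tilt towards γ. The symbol `l₀`, flat along β, is counted
twice: below along β and above along the tilt. -/
theorem crosses_of_concave (a : L → Fin d → ℝ) {E : ℝ} {x β γ : Fin d → ℝ} (l₀ : L)
    (h0 : shiftedSymbol (a l₀) x = E) (hβ : symbolSlope (a l₀) x β = 0)
    (hγ : 0 < symbolSlope (a l₀) x γ)
    (hdown : ∀ l, shiftedSymbol (a l) x = E → symbolSlope (a l) x β = 0 →
      GoesBelow (a l) x β E) : Crosses a E := by
  have hδ : ∀ᶠ δ in 𝓝[>] (0 : ℝ), ∀ l, 0 < symbolSlope (a l) x β →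
      0 < symbolSlope (a l) x (β + δ • γ) := by
    rw [eventually_all]; intro l
    by_cases hl : 0 < symbolSlope (a l) x β
    · have hc : ContinuousAt
          (fun δ : ℝ => symbolSlope (a l) x β + δ * symbolSlope (a l) x γ) 0 := by fun_prop
      filter_upwards [(hc.eventually_const_lt (by simpa using hl)).filter_mono
        nhdsWithin_le_nhds] with δ h _
      rwa [symbolSlope_add_smul]
    · exact Eventually.of_forall fun t ht => absurd ht hl
  obtain ⟨δ, h1, h2⟩ := (hδ.and self_mem_nhdsWithin).exists
  have h2 : 0 < δ := h2
  have hl₀ : GoesAbove (a l₀) x (β + δ • γ) E :=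
    goesAbove_of_slope_pos h0 (by rw [symbolSlope_add_smul, hβ, zero_add]; positivity)
  refine crosses_of_card_lt a (x := x) (x' := x) (β := β) (β' := β + δ • γ) ?_
  have hU : {l | GoesBelow (a l) x β E} ∪ {l | GoesAbove (a l) x (β + δ • γ) E} = Set.univ := by
    refine Set.eq_univ_of_forall fun l => ?_
    rcases lt_trichotomy (shiftedSymbol (a l) x) E with h | h | h
    · exact Or.inl (goesBelow_of_lt _ h)
    · rcases lt_trichotomy (symbolSlope (a l) x β) 0 with h' | h' | h'
      · exact Or.inl (goesBelow_of_slope_neg h h')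
      · exact Or.inl (hdown l h h')
      · exact Or.inr (goesAbove_of_slope_pos h (h1 l h'))
    · exact Or.inr (goesAbove_of_lt _ h)
  have hI : 0 < ({l | GoesBelow (a l) x β E} ∩ {l | GoesAbove (a l) x (β + δ • γ) E}).ncard :=
    (Set.ncard_pos).2 ⟨l₀, hdown l₀ h0 hβ, hl₀⟩
  have := Set.ncard_union_add_ncard_inter {l | GoesBelow (a l) x β E}
    {l | GoesAbove (a l) x (β + δ • γ) E}
  rw [hU, Set.ncard_univ] at this
  omega

/-- At least two unit vectors in the plane can be placed, not all horizontally, so that they sum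
to a prescribed real number. -/
theorem exists_angles (n : ℕ) : ∀ e : ℝ, |e| < n + 2 → ∃ x : Fin (n + 2) → ℝ,
    ∑ i, Real.cos (x i) = e ∧ ∑ i, Real.sin (x i) = 0 ∧ ∃ i, Real.sin (x i) ≠ 0 := by
  induction n with
  | zero =>
    intro e he
    rw [abs_lt] at he
    push_cast at he
    refine ⟨![Real.arccos (e / 2), -Real.arccos (e / 2)], ?_, ?_, 0, ?_⟩
    · simp [Fin.sum_univ_two, Real.cos_arccos (show -1 ≤ e / 2 by linarith)
        (show e / 2 ≤ 1 by linarith)]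
    · simp [Fin.sum_univ_two]
    · simp only [Matrix.cons_val_zero, Real.sin_arccos]
      refine (Real.sqrt_pos.2 ?_).ne'
      nlinarith
  | succ n ih =>
    intro e he
    rw [abs_lt] at he
    push_cast at he
    -- One vector is placed at 1 or -1, on the side that brings the remaining sum closer to the
    -- allowed range.
    rcases le_total 0 e with h | h
    · obtain ⟨x, h1, h2, i, h3⟩ := ih (e - 1) (by rw [abs_lt]; constructor <;> linarith)
      refine ⟨Fin.cons 0 x, ?_, ?_, i.succ, by simpa using h3⟩
      · rw [Fin.sum_univ_succ]; simp [h1]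
      · rw [Fin.sum_univ_succ]; simp [h2]
    · obtain ⟨x, h1, h2, i, h3⟩ := ih (e + 1) (by rw [abs_lt]; constructor <;> linarith)
      refine ⟨Fin.cons Real.pi x, ?_, ?_, i.succ, by simpa using h3⟩
      · rw [Fin.sum_univ_succ]; simp [h1]
      · rw [Fin.sum_univ_succ]; simp [h2]

theorem symbolSlope_neg_sin_pos {x : Fin d → ℝ} (h : ∃ i, Real.sin (x i) ≠ 0) :
    0 < symbolSlope 0 x (fun i => -Real.sin (x i)) := by
  obtain ⟨i, hi⟩ := h
  simp only [symbolSlope, Pi.zero_apply, add_zero, mul_neg, Finset.sum_neg_distrib, neg_neg]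
  refine Finset.sum_pos' (fun j _ => ?_) ⟨i, Finset.mem_univ _, ?_⟩
  · rw [mul_assoc]; exact mul_nonneg zero_le_two (mul_self_nonneg _)
  · rw [mul_assoc]; exact mul_pos zero_lt_two (mul_self_pos.2 hi)

/-- The point is chosen so that the unshifted symbol equals E and is flat along the diagonal but has
nonzero gradient; γ is a multiple of that gradient. -/
theorem crosses_of_pos (hd : 2 ≤ d) (a : L → Fin d → ℝ) {l₀ : L} (hl₀ : a l₀ = 0) {E : ℝ}
    (hE : 0 < E) (hE' : E < 2 * d) : Crosses a E := by
  obtain ⟨n, rfl⟩ := Nat.exists_eq_add_of_le' hd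
  push_cast at hE'
  obtain ⟨x, h1, h2, h3⟩ := exists_angles n (E / 2)
    (by rw [abs_lt]; constructor <;> linarith)
  refine crosses_of_concave a (x := x) (β := 1) (γ := fun i => -Real.sin (x i)) l₀ ?_ ?_ ?_
    fun l h h' => goesBelow_one_of_slope_eq_zero hE h h'
  · simp [shiftedSymbol, hl₀, ← Finset.mul_sum, h1]
    ring
  · simp [symbolSlope, hl₀, ← Finset.mul_sum, h2]
  · rw [hl₀]; exact symbolSlope_neg_sin_pos h3

/-- Shifting every coordinate by π negates all symbols, and passing to complements exchanges the
strict and the weak count. -/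
theorem Crosses.neg {a : L → Fin d → ℝ} {E : ℝ} (h : Crosses a E) : Crosses a (-E) := by
  obtain ⟨y, y', h⟩ := h
  refine ⟨y' + fun _ => Real.pi, y + fun _ => Real.pi, ?_⟩
  simp only [shiftedSymbol_add_pi, neg_le_neg_iff, neg_lt_neg_iff]
  have e1 := Set.ncard_add_ncard_compl {l | shiftedSymbol (a l) y' ≤ E}
  have e2 := Set.ncard_add_ncard_compl {l | shiftedSymbol (a l) y < E}
  simp only [Set.compl_ofPred, not_le, not_lt] at e1 e2
  omega

/-- With `X j = 0`, a symbol flat along the j-th axis has its j-th cosine at the maximum 1, by `hj`,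
so it goes below. The remaining coordinates, at least two of them, make the sum vanish while keeping
the gradient nonzero. -/
theorem crosses_zero_of_three_le (hd : 3 ≤ d) (a : L → Fin d → ℝ) {l₀ : L} (hl₀ : a l₀ = 0)
    {j : Fin d} (hj : ∀ l, Real.sin (a l j) = 0 → Real.cos (a l j) = 1) : Crosses a 0 := by
  obtain ⟨n, rfl⟩ := Nat.exists_eq_add_of_le' hd
  obtain ⟨x, h1, h2, i, h3⟩ := exists_angles n (-1)
    (by rw [abs_neg, abs_one]; have : (0 : ℝ) ≤ n := n.cast_nonneg; linarith)
  let X : Fin (n + 3) → ℝ := Fin.insertNth j 0 x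
  have hX : X j = 0 := by simp [X]
  refine crosses_of_concave a (x := X) (β := Pi.single j 1) (γ := fun i => -Real.sin (X i)) l₀
    ?_ ?_ ?_ fun l h h' => ?_
  · simp only [shiftedSymbol, hl₀, ← Finset.mul_sum, Pi.zero_apply, add_zero]
    rw [Fin.sum_univ_succAbove _ j]
    simp [X, h1]
  · simp [symbolSlope_single, hX, hl₀]
  · rw [hl₀]; exact symbolSlope_neg_sin_pos ⟨j.succAbove i, by simpa [X] using h3⟩
  · rw [symbolSlope_single, hX, zero_add] at h'
    have := goesBelow_single_of_cos_eq_one (s := 1) (i := j) h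
      (by rw [hX, zero_add]; exact hj l (by linarith)) (Or.inl rfl)
    rwa [one_smul] at this

/-- In two dimensions the point with coordinates 0 (at j) and π (at k) is critical for the unshifted
symbol, so tilting is unavailable. Instead one descends along ±j and ascends along ±k, and averages
over the sign. -/
theorem crosses_zero_of_two (a : L → Fin 2 → ℝ) {l₀ : L} (hl₀ : a l₀ = 0)
    {j : Fin 2} (hj : ∀ l, Real.sin (a l j) = 0 → Real.cos (a l j) = 1) : Crosses a 0 := by
  obtain ⟨k, hk, hsum⟩ : ∃ k, k ≠ j ∧ ∀ f : Fin 2 → ℝ, ∑ i, f i = f j + f k := by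
    refine ⟨j + 1, by simp, fun f => ?_⟩
    fin_cases j <;> simp [Fin.sum_univ_two, add_comm]
  let x : Fin 2 → ℝ := Pi.single k Real.pi
  have hxj : x j = 0 := by simp [x, hk.symm]
  have hxk : x k = Real.pi := by simp [x]
  have hf : ∀ l, shiftedSymbol (a l) x = 2 * Real.cos (a l j) - 2 * Real.cos (a l k) := by
    intro l
    rw [shiftedSymbol, hsum, hxj, hxk, zero_add, add_comm Real.pi, Real.cos_add_pi]; ring
  set A : ℝ → Set L := fun s => {l | GoesBelow (a l) x (s • Pi.single j 1) 0} with hA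
  set B : ℝ → Set L := fun s => {l | GoesAbove (a l) x (s • Pi.single k 1) 0} with hB
  have hjc : ∀ l, Real.sin (a l j) = 0 → Real.cos (x j + a l j) = 1 := fun l h => by
    rw [hxj, zero_add]; exact hj l h
  -- At level 0 the two cosines agree, so flatness along k forces flatness along j; then `hj` puts
  -- the k-th cosine at its minimum.
  have hkc : ∀ l, shiftedSymbol (a l) x = 0 → Real.sin (a l k) = 0 →
      Real.cos (x k + a l k) = -1 := by
    intro l h hs
    rw [hxk, add_comm, Real.cos_add_pi]
    rw [hf] at h
    have h' : Real.cos (a l j) = Real.cos (a l k) := by linarith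
    have hs' : Real.sin (a l j) = 0 := by
      have e1 := Real.sin_sq_add_cos_sq (a l j)
      have e2 := Real.sin_sq_add_cos_sq (a l k)
      rw [h'] at e1; rw [hs] at e2
      nlinarith
    rw [← h', hj l hs']
  have slope_j : ∀ l (s : ℝ), symbolSlope (a l) x (s • Pi.single j 1) =
      -(2 * s * Real.sin (a l j)) := by
    intro l s
    have := symbolSlope_add_smul (a l) x 0 (Pi.single j 1) s
    rw [zero_add, symbolSlope_single, hxj, zero_add] at this
    rw [this]; simp [symbolSlope]; ring
  have slope_k : ∀ l (s : ℝ), symbolSlope (a l) x (s • Pi.single k 1) =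
      2 * s * Real.sin (a l k) := by
    intro l s
    have := symbolSlope_add_smul (a l) x 0 (Pi.single k 1) s
    rw [zero_add, symbolSlope_single, hxk, add_comm Real.pi, Real.sin_add_pi] at this
    rw [this]; simp [symbolSlope]; ring
  have hzero : shiftedSymbol (a l₀) x = 0 := by rw [hf, hl₀]; simp
  have hl₀j : ∀ s : ℝ, s = 1 ∨ s = -1 → l₀ ∈ A s := fun s hs =>
    goesBelow_single_of_cos_eq_one hzero (hjc _ (by simp [hl₀])) hs
  have hl₀k : ∀ s : ℝ, s = 1 ∨ s = -1 → l₀ ∈ B s := fun s hs =>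
    goesAbove_single_of_cos_eq_neg_one hzero (hkc _ hzero (by simp [hl₀])) hs
  have key : ∀ l, (shiftedSymbol (a l) x < 0 → l ∈ A 1 ∩ A (-1)) ∧
      (0 < shiftedSymbol (a l) x → l ∈ B 1 ∩ B (-1)) ∧
      (shiftedSymbol (a l) x = 0 → l ∈ (A 1 ∪ A (-1)) ∩ (B 1 ∪ B (-1))) := by
    intro l
    refine ⟨fun h => ⟨goesBelow_of_lt _ h, goesBelow_of_lt _ h⟩,
      fun h => ⟨goesAbove_of_lt _ h, goesAbove_of_lt _ h⟩, fun h => ⟨?_, ?_⟩⟩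
    · rcases lt_trichotomy (Real.sin (a l j)) 0 with h' | h' | h'
      · exact Or.inr (goesBelow_of_slope_neg h (by rw [slope_j]; linarith))
      · exact Or.inl (goesBelow_single_of_cos_eq_one h (hjc _ h') (Or.inl rfl))
      · exact Or.inl (goesBelow_of_slope_neg h (by rw [slope_j]; linarith))
    · rcases lt_trichotomy (Real.sin (a l k)) 0 with h' | h' | h'
      · exact Or.inr (goesAbove_of_slope_pos h (by rw [slope_k]; linarith))
      · exact Or.inl (goesAbove_single_of_cos_eq_neg_one h (hkc _ h h') (Or.inl rfl))
      · exact Or.inl (goesAbove_of_slope_pos h (by rw [slope_k]; linarith))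
  have hcov1 : (A 1 ∪ A (-1)) ∪ (B 1 ∩ B (-1)) = Set.univ := by
    refine Set.eq_univ_of_forall fun l => ?_
    rcases lt_trichotomy (shiftedSymbol (a l) x) 0 with h | h | h
    · exact Or.inl (Or.inl ((key l).1 h).1)
    · exact Or.inl ((key l).2.2 h).1
    · exact Or.inr ((key l).2.1 h)
  have hcov2 : (A 1 ∩ A (-1)) ∪ (B 1 ∪ B (-1)) = Set.univ := by
    refine Set.eq_univ_of_forall fun l => ?_
    rcases lt_trichotomy (shiftedSymbol (a l) x) 0 with h | h | h
    · exact Or.inl ((key l).1 h)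
    · exact Or.inr ((key l).2.2 h).2
    · exact Or.inr (Or.inl ((key l).2.1 h).1)
  -- The four cardinalities add up to those of the two unions plus the two intersections. The two
  -- covers of L bound this below by 2|L|, and `l₀`, counted twice in the first cover, makes the
  -- bound strict; so one sign has a sum exceeding |L|.
  have e1 := Set.ncard_union_add_ncard_inter (A 1) (A (-1))
  have e2 := Set.ncard_union_add_ncard_inter (B 1) (B (-1))
  have e3 := Set.ncard_union_add_ncard_inter (A 1 ∪ A (-1)) (B 1 ∩ B (-1))
  have e4 := Set.ncard_union_add_ncard_inter (A 1 ∩ A (-1)) (B 1 ∪ B (-1))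
  rw [hcov1, Set.ncard_univ] at e3
  rw [hcov2, Set.ncard_univ] at e4
  have e5 : 0 < ((A 1 ∪ A (-1)) ∩ (B 1 ∩ B (-1))).ncard :=
    (Set.ncard_pos).2 ⟨l₀, Or.inl (hl₀j 1 (Or.inl rfl)), hl₀k 1 (Or.inl rfl), hl₀k _ (Or.inr rfl)⟩
  have e6 : Nat.card L < (A 1).ncard + (B 1).ncard ∨ Nat.card L < (A (-1)).ncard + (B (-1)).ncard := by
    omega
  rcases e6 with h | h
  · exact crosses_of_card_lt a h
  · exact crosses_of_card_lt a h

/-- Every interior energy is crossed, except possibly `0`. -/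
theorem crosses_of_abs_lt (hd : 2 ≤ d) (a : L → Fin d → ℝ) {l₀ : L} (hl₀ : a l₀ = 0) {E : ℝ}
    (hE : |E| < 2 * d)
    (h : E ≠ 0 ∨ ∃ j, ∀ l, Real.sin (a l j) = 0 → Real.cos (a l j) = 1) : Crosses a E := by
  rw [abs_lt] at hE
  rcases lt_trichotomy E 0 with h0 | h0 | h0
  · have := (crosses_of_pos hd a hl₀ (E := -E) (by linarith) (by linarith)).neg
    rwa [neg_neg] at this
  · subst h0
    obtain ⟨j, hj⟩ := h.resolve_left (by simp)
    rcases hd.eq_or_lt with rfl | hd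
    · exact crosses_zero_of_two a hl₀ hj
    · exact crosses_zero_of_three_le hd a hl₀ hj
  · exact crosses_of_pos hd a hl₀ h0 hE.2

theorem countable_cos_eq (b c : ℝ) : {t : ℝ | Real.cos (t + b) = c}.Countable := by
  by_cases h : ∃ s, Real.cos s = c
  · obtain ⟨s, rfl⟩ := h
    refine ((Set.countable_range fun k : ℤ => s - 2 * k * Real.pi - b).union
      (Set.countable_range fun k : ℤ => 2 * k * Real.pi - s - b)).mono ?_
    intro t ht
    rw [Set.mem_ofPred_eq, Real.cos_eq_cos_iff] at ht
    obtain ⟨k, hk | hk⟩ := ht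
    · exact Or.inl ⟨k, by simp only; linarith⟩
    · exact Or.inr ⟨k, by simp only; linarith⟩
  · convert! Set.countable_empty
    ext t; simp only [Set.mem_ofPred_eq, Set.mem_empty_iff_false, iff_false]
    exact fun ht => h ⟨_, ht⟩

/-- On a coordinate line each of the finitely many symbols takes the value c only countably often.
This will show that no free band is constant. -/
theorem exists_forall_shiftedSymbol_ne (hd : 0 < d) (a : L → Fin d → ℝ) (c : ℝ) :
    ∃ y, ∀ l, shiftedSymbol (a l) y ≠ c := by
  let i : Fin d := ⟨0, hd⟩
  have hcount : (⋃ l, {t : ℝ | shiftedSymbol (a l) (0 + t • Pi.single i 1) = c}).Countable := by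
    refine Set.countable_iUnion fun l => (countable_cos_eq (a l i)
      ((c - shiftedSymbol (a l) 0) / 2 + Real.cos (a l i))).mono fun t ht => ?_
    rw [Set.mem_ofPred_eq, shiftedSymbol_add_single, Pi.zero_apply, zero_add, add_comm (a l i)] at ht
    rw [Set.mem_ofPred_eq]; linarith
  obtain ⟨t, ht⟩ := (hcount.dense_compl ℝ).nonempty
  exact ⟨_, fun l hl => ht (Set.mem_iUnion.2 ⟨l, hl⟩)⟩

end crossing

/-! ### Ordered eigenvalues of symmetric maps -/

namespace LinearMap.IsSymmetric

variable {W : Type*} [NormedAddCommGroup W] [InnerProductSpace ℂ W] [FiniteDimensional ℂ W]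
  {n : ℕ} {S T : W →ₗ[ℂ] W}

theorem re_inner_apply_self_eq_sum (hT : T.IsSymmetric) (hn : Module.finrank ℂ W = n) (x : W) :
    (⟪T x, x⟫_ℂ).re =
      ∑ i, hT.eigenvalues hn i * ‖(hT.eigenvectorBasis hn).repr x i‖ ^ 2 := by
  rw [← (hT.eigenvectorBasis hn).repr.inner_map_map, PiLp.inner_apply, Complex.re_sum]
  refine Finset.sum_congr rfl fun i _ => ?_
  rw [hT.eigenvectorBasis_apply_self_apply hn x i, RCLike.inner_apply, map_mul,
    ← Complex.normSq_eq_norm_sq, mul_left_comm, Complex.mul_conj]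
  simp [← Complex.ofReal_mul]

theorem norm_sq_eq_sum_repr (hT : T.IsSymmetric) (hn : Module.finrank ℂ W = n) (x : W) :
    ‖x‖ ^ 2 = ∑ i, ‖(hT.eigenvectorBasis hn).repr x i‖ ^ 2 := by
  rw [← (hT.eigenvectorBasis hn).repr.norm_map, EuclideanSpace.norm_sq_eq]

/-- A self-adjoint map is bounded below by the distance from its spectrum. -/
theorem le_norm_apply_sub_smul (hT : T.IsSymmetric) (hn : Module.finrank ℂ W = n) {E c : ℝ}
    (hc : 0 ≤ c) (h : ∀ i, c ≤ |hT.eigenvalues hn i - E|) (x : W) :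
    c * ‖x‖ ≤ ‖T x - (E : ℂ) • x‖ := by
  refine (sq_le_sq₀ (by positivity) (norm_nonneg _)).1 ?_
  rw [mul_pow, hT.norm_sq_eq_sum_repr hn, hT.norm_sq_eq_sum_repr hn, Finset.mul_sum]
  refine Finset.sum_le_sum fun i _ => ?_
  rw [map_sub, map_smul, PiLp.sub_apply, PiLp.smul_apply,
    hT.eigenvectorBasis_apply_self_apply hn x i, smul_eq_mul, ← sub_mul, norm_mul, mul_pow]
  refine mul_le_mul_of_nonneg_right ?_ (by positivity)
  refine pow_le_pow_left₀ hc ?_ 2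
  have := h i
  rwa [← Real.norm_eq_abs, ← Complex.norm_real, Complex.ofReal_sub] at this

/-- Weyl's monotonicity inequality for ordered eigenvalues. -/
theorem eigenvalues_le_add (hS : S.IsSymmetric) (hT : T.IsSymmetric)
    (hn : Module.finrank ℂ W = n) {ε : ℝ}
    (h : ∀ x, (⟪S x, x⟫_ℂ).re ≤ (⟪T x, x⟫_ℂ).re + ε * ‖x‖ ^ 2) (k : Fin n) :
    hS.eigenvalues hn k ≤ hT.eigenvalues hn k + ε := by
  -- Only n - 1 conditions are imposed, so some nonzero x lies both in the span of the
  -- S-eigenvectors of index ≤ k and in that of the T-eigenvectors of index ≥ k. Eigenvalues are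
  -- listed in decreasing order.
  let F : W →ₗ[ℂ] ({i : Fin n // i ≠ k} → ℂ) :=
    { toFun := fun x i => if k < i.1 then (hS.eigenvectorBasis hn).repr x i.1
        else (hT.eigenvectorBasis hn).repr x i.1
      map_add' := fun x y => by ext i; dsimp; split_ifs <;> simp
      map_smul' := fun c x => by ext i; dsimp; split_ifs <;> simp }
  have hF : F.ker ≠ ⊥ := F.ker_ne_bot_of_finrank_lt (by
    rw [Module.finrank_fintype_fun_eq_card, Fintype.card_subtype_compl, hn]
    have := k.2
    simp; omega)
  obtain ⟨x, hx, hx0⟩ := Submodule.exists_mem_ne_zero_of_ne_bot hF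
  have hxi : ∀ i (hi : i ≠ k), F x ⟨i, hi⟩ = 0 := fun i hi => congrFun (LinearMap.mem_ker.1 hx) _
  have hS0 : ∀ i, k < i → (hS.eigenvectorBasis hn).repr x i = 0 := fun i hi => by
    have := hxi i hi.ne'
    simpa only [F, LinearMap.coe_mk, AddHom.coe_mk, hi, if_true] using this
  have hT0 : ∀ i, i < k → (hT.eigenvectorBasis hn).repr x i = 0 := fun i hi => by
    have := hxi i hi.ne
    simpa only [F, LinearMap.coe_mk, AddHom.coe_mk, hi.not_gt, if_false] using this
  have e1 : hS.eigenvalues hn k * ‖x‖ ^ 2 ≤ (⟪S x, x⟫_ℂ).re := by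
    rw [hS.re_inner_apply_self_eq_sum hn, hS.norm_sq_eq_sum_repr hn, Finset.mul_sum]
    refine Finset.sum_le_sum fun i _ => ?_
    rcases le_or_gt i k with hi | hi
    · exact mul_le_mul_of_nonneg_right (hS.eigenvalues_antitone hn hi) (by positivity)
    · simp [hS0 i hi]
  have e2 : (⟪T x, x⟫_ℂ).re ≤ hT.eigenvalues hn k * ‖x‖ ^ 2 := by
    rw [hT.re_inner_apply_self_eq_sum hn, hT.norm_sq_eq_sum_repr hn, Finset.mul_sum]
    refine Finset.sum_le_sum fun i _ => ?_
    rcases le_or_gt k i with hi | hi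
    · exact mul_le_mul_of_nonneg_right (hT.eigenvalues_antitone hn hi) (by positivity)
    · simp [hT0 i hi]
  have hpos : 0 < ‖x‖ ^ 2 := by positivity
  have := h x
  refine le_of_mul_le_mul_right ?_ hpos
  linarith

/-- Both families are the roots of the characteristic polynomial with multiplicity, so the basis
need not be orthonormal. -/
theorem card_eigenvalues_eq_card_of_basis (hT : T.IsSymmetric) (hn : Module.finrank ℂ W = n)
    {ι : Type*} [Fintype ι] (b : Module.Basis ι ℂ W) (f : ι → ℝ)
    (hb : ∀ l, T (b l) = (f l : ℂ) • b l) (p : ℝ → Prop) :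
    {i | p (hT.eigenvalues hn i)}.ncard = {l | p (f l)}.ncard := by
  classical
  have h1 : T.charpoly.roots = Multiset.map (fun l => (f l : ℂ)) Finset.univ.val := by
    have : LinearMap.toMatrix b b T = Matrix.diagonal fun l => (f l : ℂ) := by
      ext i j
      rw [LinearMap.toMatrix_apply, hb, map_smul, Module.Basis.repr_self, Finsupp.smul_apply,
        Matrix.diagonal_apply, Finsupp.single_apply]
      by_cases hij : i = j
      · subst hij; simp
      · simp [hij, Ne.symm hij]
    rw [← LinearMap.charpoly_toMatrix T b, this, Matrix.charpoly_diagonal,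
      Polynomial.roots_prod _ _ (by
        simp [Finset.prod_ne_zero_iff, Polynomial.X_sub_C_ne_zero])]
    simp
  have h2 := hT.roots_charpoly_eq_eigenvalues hn
  rw [h1] at h2
  have h3 := congrArg (Multiset.countP fun z : ℂ => p z.re) h2
  rw [Multiset.countP_map, Multiset.countP_map] at h3
  rw [Set.ncard_eq_toFinset_card', Set.ncard_eq_toFinset_card', Set.toFinset_ofPred,
    Set.toFinset_ofPred]
  simpa [Finset.card_def, Finset.filter_val] using h3.symm

end LinearMap.IsSymmetric

theorem eigenvalues_sub_le_norm {W : Type*} [NormedAddCommGroup W] [InnerProductSpace ℂ W]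
    [FiniteDimensional ℂ W] {n : ℕ} {S T : W →L[ℂ] W} (hS : (S : W →ₗ[ℂ] W).IsSymmetric)
    (hT : (T : W →ₗ[ℂ] W).IsSymmetric) (hn : Module.finrank ℂ W = n) (k : Fin n) :
    |hS.eigenvalues hn k - hT.eigenvalues hn k| ≤ ‖S - T‖ := by
  have key : ∀ {S T : W →L[ℂ] W} (hS : (S : W →ₗ[ℂ] W).IsSymmetric)
      (hT : (T : W →ₗ[ℂ] W).IsSymmetric),
      hS.eigenvalues hn k ≤ hT.eigenvalues hn k + ‖S - T‖ := by
    intro S T hS hT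
    refine hS.eigenvalues_le_add hT hn (fun x => ?_) k
    have h1 : (⟪(S - T) x, x⟫_ℂ).re ≤ ‖S - T‖ * ‖x‖ ^ 2 :=
      (Complex.re_le_norm _).trans ((norm_inner_le_norm _ _).trans (by
        rw [pow_two, ← mul_assoc]; gcongr; exact (S - T).le_opNorm x))
    rw [sub_apply, inner_sub_left, Complex.sub_re] at h1
    simp only [ContinuousLinearMap.coe_coe]
    linarith
  rw [abs_le]
  have h1 := key hS hT
  have h2 := key hT hS
  rw [norm_sub_rev] at h2
  constructor <;> linarith

/-! ### Bloch fibres and band functions -/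

section bloch

variable {d : ℕ} {G : Type*} [AddCommGroup G] [Fintype G]

/-- Translation by `g` on functions on a finite abelian group. -/
def groupShift (g : G) : EuclideanSpace ℂ G →L[ℂ] EuclideanSpace ℂ G :=
  LinearMap.toContinuousLinearMap
    { toFun := fun u => WithLp.toLp 2 fun m => u (m + g)
      map_add' := fun _ _ => rfl
      map_smul' := fun _ _ => rfl }

@[simp]
theorem groupShift_apply (g : G) (u : EuclideanSpace ℂ G) (m : G) :
    groupShift g u m = u (m + g) := rfl

/-- Multiplication by a real function on a finite abelian group. -/
def groupMultiplication (v : G → ℝ) : EuclideanSpace ℂ G →L[ℂ] EuclideanSpace ℂ G :=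
  LinearMap.toContinuousLinearMap
    { toFun := fun u => WithLp.toLp 2 fun m => (v m : ℂ) * u m
      map_add' := fun x y => by ext m; simp [mul_add]
      map_smul' := fun c x => by ext m; simp [mul_left_comm] }

@[simp]
theorem groupMultiplication_apply (v : G → ℝ) (u : EuclideanSpace ℂ G) (m : G) :
    groupMultiplication v u m = v m * u m := rfl

/-- The Bloch fibre at quasimomentum `θ` of the Schrödinger operator whose potential is the
pullback of `v` along the homomorphism sending the `i`-th basis vector to `b i`. -/
def blochOperator (b : Fin d → G) (v : G → ℝ) (θ : Fin d → ℝ) :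
    EuclideanSpace ℂ G →L[ℂ] EuclideanSpace ℂ G :=
  ∑ i, (Complex.exp (θ i * Complex.I) • groupShift (b i) +
    Complex.exp (-(θ i * Complex.I)) • groupShift (-b i)) + groupMultiplication v

theorem blochOperator_apply (b : Fin d → G) (v : G → ℝ) (θ : Fin d → ℝ)
    (u : EuclideanSpace ℂ G) (m : G) :
    blochOperator b v θ u m =
      ∑ i, (Complex.exp (θ i * Complex.I) * u (m + b i) +
        Complex.exp (-(θ i * Complex.I)) * u (m - b i)) + v m * u m := by
  simp [blochOperator, sub_eq_add_neg, sum_apply, WithLp.ofLp_sum, Finset.sum_apply]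

theorem inner_groupShift_left (g : G) (u w : EuclideanSpace ℂ G) :
    ⟪groupShift g u, w⟫_ℂ = ⟪u, groupShift (-g) w⟫_ℂ := by
  simp only [PiLp.inner_apply, groupShift_apply]
  rw [← Equiv.sum_comp (Equiv.addRight g) fun m => ⟪u m, w (m + -g)⟫_ℂ]
  simp

theorem inner_groupMultiplication_left (v : G → ℝ) (u w : EuclideanSpace ℂ G) :
    ⟪groupMultiplication v u, w⟫_ℂ = ⟪u, groupMultiplication v w⟫_ℂ := by
  simp only [PiLp.inner_apply, groupMultiplication_apply, RCLike.inner_apply, map_mul]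
  refine Finset.sum_congr rfl fun m _ => ?_
  simp; ring

theorem conj_exp_mul_I (t : ℝ) :
    (starRingEnd ℂ) (Complex.exp (t * Complex.I)) = Complex.exp (-(t * Complex.I)) := by
  rw [← Complex.exp_conj]; simp

theorem conj_exp_neg_mul_I (t : ℝ) :
    (starRingEnd ℂ) (Complex.exp (-(t * Complex.I))) = Complex.exp (t * Complex.I) := by
  rw [← Complex.exp_conj]; simp

theorem blochOperator_isSymmetric (b : Fin d → G) (v : G → ℝ) (θ : Fin d → ℝ) :
    (blochOperator b v θ : EuclideanSpace ℂ G →ₗ[ℂ] EuclideanSpace ℂ G).IsSymmetric := by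
  intro u w
  simp only [ContinuousLinearMap.coe_coe, blochOperator, add_apply, sum_apply, smul_apply,
    inner_add_left, inner_add_right, sum_inner, inner_sum, inner_smul_left, inner_smul_right,
    inner_groupShift_left, inner_groupMultiplication_left, neg_neg, conj_exp_mul_I,
    conj_exp_neg_mul_I]
  congr 1
  exact Finset.sum_congr rfl fun i _ => add_comm _ _

/-- The `k`-th largest eigenvalue of the Bloch fibre. -/
def bandFunction (b : Fin d → G) (v : G → ℝ) (k : Fin (Fintype.card G)) (θ : Fin d → ℝ) : ℝ :=
  (blochOperator_isSymmetric b v θ).eigenvalues finrank_euclideanSpace k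

theorem bandFunction_antitone (b : Fin d → G) (v : G → ℝ) (θ : Fin d → ℝ) :
    Antitone fun k => bandFunction b v k θ :=
  (blochOperator_isSymmetric b v θ).eigenvalues_antitone finrank_euclideanSpace

theorem abs_bandFunction_sub_le (b : Fin d → G) (v v' : G → ℝ) (k : Fin (Fintype.card G))
    (θ θ' : Fin d → ℝ) : |bandFunction b v k θ - bandFunction b v' k θ'| ≤
      ‖blochOperator b v θ - blochOperator b v' θ'‖ :=
  eigenvalues_sub_le_norm _ _ _ _

theorem continuous_blochOperator (b : Fin d → G) (v : G → ℝ) :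
    Continuous (blochOperator b v) := by
  unfold blochOperator
  fun_prop

theorem continuous_bandFunction (b : Fin d → G) (v : G → ℝ) (k : Fin (Fintype.card G)) :
    Continuous (bandFunction b v k) := by
  rw [continuous_iff_continuousAt]
  intro θ
  rw [ContinuousAt, tendsto_iff_norm_sub_tendsto_zero]
  refine squeeze_zero (fun _ => norm_nonneg _)
    (fun θ' => abs_bandFunction_sub_le b v v k θ' θ) ?_
  exact tendsto_iff_norm_sub_tendsto_zero.1 (continuous_blochOperator b v).continuousAt

theorem abs_bandFunction_sub_zero_le (b : Fin d → G) {v : G → ℝ} {c : ℝ} (hc : ∀ m, |v m| ≤ c)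
    (k : Fin (Fintype.card G)) (θ : Fin d → ℝ) :
    |bandFunction b v k θ - bandFunction b 0 k θ| ≤ c := by
  have hc0 : 0 ≤ c := (abs_nonneg _).trans (hc 0)
  refine (abs_bandFunction_sub_le b v 0 k θ θ).trans ?_
  refine ContinuousLinearMap.opNorm_le_bound _ hc0 fun u => ?_
  have : (blochOperator b v θ - blochOperator b 0 θ) u = groupMultiplication v u := by
    ext m
    simp [blochOperator_apply]
  rw [this]
  refine (sq_le_sq₀ (norm_nonneg _) (by positivity)).1 ?_
  rw [mul_pow, EuclideanSpace.norm_sq_eq, EuclideanSpace.norm_sq_eq, Finset.mul_sum]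
  refine Finset.sum_le_sum fun m _ => ?_
  rw [groupMultiplication_apply, norm_mul, mul_pow, Complex.norm_real, Real.norm_eq_abs]
  gcongr
  exact hc m

/-- A band is continuous on a connected space and 2π-periodic in each coordinate, so its range is
connected and compact. -/
theorem range_bandFunction (b : Fin d → G) (v : G → ℝ) (k : Fin (Fintype.card G)) :
    ∃ l r, Set.range (bandFunction b v k) = Set.Icc l r := by
  have hcont := continuous_bandFunction b v k
  have hcpt : Set.range (bandFunction b v k) =
      bandFunction b v k '' Set.Icc 0 (fun _ => 2 * Real.pi) := by
    refine (Set.image_subset_range _ _).antisymm' ?_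
    rintro _ ⟨θ, rfl⟩
    refine ⟨fun i => toIcoMod Real.two_pi_pos 0 (θ i), ⟨fun i => ?_, fun i => ?_⟩, ?_⟩
    · exact (toIcoMod_mem_Ico Real.two_pi_pos 0 (θ i)).1
    · have := (toIcoMod_mem_Ico Real.two_pi_pos 0 (θ i)).2
      rw [zero_add] at this
      exact this.le
    · have hexp : ∀ i, Complex.exp ((toIcoMod Real.two_pi_pos 0 (θ i) : ℝ) * Complex.I) =
          Complex.exp (θ i * Complex.I) := by
        intro i
        rw [toIcoMod, Complex.exp_eq_exp_iff_exists_int]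
        refine ⟨-toIcoDiv Real.two_pi_pos 0 (θ i), ?_⟩
        push_cast [zsmul_eq_mul]
        ring
      have : blochOperator b v (fun i => toIcoMod Real.two_pi_pos 0 (θ i)) =
          blochOperator b v θ := by
        simp only [blochOperator, Complex.exp_neg, hexp]
      unfold bandFunction
      simp only [this]
  obtain hconn : IsConnected (Set.range (bandFunction b v k)) :=
    isConnected_range hcont
  refine ⟨_, _, eq_Icc_of_connected_compact hconn ?_⟩
  rw [hcpt]
  exact isCompact_Icc.image hcont

/-! ### The free bands -/

section free

/-- The phases of the value of a character at the vectors `b i`. -/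
def characterPhase (b : Fin d → G) (χ : AddChar G ℂ) (i : Fin d) : ℝ := Complex.arg (χ (b i))

theorem exp_characterPhase (b : Fin d → G) (χ : AddChar G ℂ) (i : Fin d) :
    Complex.exp (characterPhase b χ i * Complex.I) = χ (b i) := by
  have := Complex.norm_mul_exp_arg_mul_I (χ (b i))
  rwa [AddChar.norm_apply, Complex.ofReal_one, one_mul] at this

theorem characterPhase_one (b : Fin d → G) : characterPhase b (1 : AddChar G ℂ) = 0 := by
  ext i; simp [characterPhase]

/-- The value of χ at `b j` is a q-th root of unity, and -1 is not one for odd q. -/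
theorem cos_characterPhase_of_odd {b : Fin d → G} {j : Fin d} {q : ℕ} (hq : Odd q)
    (hb : q • b j = 0) (χ : AddChar G ℂ) (h : Real.sin (characterPhase b χ j) = 0) :
    Real.cos (characterPhase b χ j) = 1 := by
  rcases Real.sin_eq_zero_iff_cos_eq.1 h with h1 | h1
  · exact h1
  · exfalso
    have e := exp_characterPhase b χ j
    rw [Complex.exp_mul_I, ← Complex.ofReal_cos, ← Complex.ofReal_sin, h, h1] at e
    have e2 : χ (q • b j) = χ (b j) ^ q := AddChar.map_nsmul_eq_pow _ _ _
    rw [hb, AddChar.map_zero_eq_one, ← e] at e2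
    simp [hq.neg_one_pow] at e2
    norm_num at e2

theorem blochOperator_zero_character (b : Fin d → G) (θ : Fin d → ℝ) (χ : AddChar G ℂ) :
    blochOperator b 0 θ (WithLp.toLp 2 χ) =
      (shiftedSymbol (characterPhase b χ) θ : ℂ) • WithLp.toLp 2 (χ : G → ℂ) := by
  ext m
  rw [blochOperator_apply, PiLp.smul_apply, smul_eq_mul]
  simp only [Pi.zero_apply, Complex.ofReal_zero, zero_mul, add_zero, shiftedSymbol,
    Complex.ofReal_sum, Finset.sum_mul]
  refine Finset.sum_congr rfl fun i _ => ?_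
  rw [sub_eq_add_neg, AddChar.map_add_eq_mul, AddChar.map_add_eq_mul,
    AddChar.map_neg_eq_inv, ← exp_characterPhase, ← Complex.exp_neg]
  push_cast
  rw [Complex.two_cos, add_mul (θ i : ℂ), neg_mul, add_mul (θ i : ℂ), neg_add, Complex.exp_add,
    Complex.exp_add]
  ring

/-- Characters form an eigenbasis of the free fibre; this transfers counts of symbols to counts of
bands. -/
theorem ncard_bandFunction_zero (b : Fin d → G) (θ : Fin d → ℝ) (p : ℝ → Prop) :
    {k | p (bandFunction b 0 k θ)}.ncard =
      {χ : AddChar G ℂ | p (shiftedSymbol (characterPhase b χ) θ)}.ncard := by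
  classical
  refine (blochOperator_isSymmetric b 0 θ).card_eigenvalues_eq_card_of_basis
    finrank_euclideanSpace
    ((AddChar.complexBasis G).map (WithLp.linearEquiv 2 ℂ (G → ℂ)).symm)
    (fun χ => shiftedSymbol (characterPhase b χ) θ) (fun χ => ?_) p
  simpa using blochOperator_zero_character b θ χ

theorem exists_forall_bandFunction_zero_ne (hd : 0 < d) (b : Fin d → G) (c : ℝ) :
    ∃ θ, ∀ k, bandFunction b 0 k θ ≠ c := by
  obtain ⟨θ, hθ⟩ := exists_forall_shiftedSymbol_ne hd (characterPhase (G := G) b) c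
  refine ⟨θ, fun k hk => ?_⟩
  have h1 := ncard_bandFunction_zero b θ (· = c)
  have h2 : {χ : AddChar G ℂ | shiftedSymbol (characterPhase b χ) θ = c} = ∅ :=
    Set.eq_empty_of_forall_notMem fun χ h => hθ χ h
  rw [h2, Set.ncard_empty, Set.ncard_eq_zero] at h1
  exact Set.notMem_empty k (h1 ▸ hk)

theorem abs_bandFunction_zero_le (b : Fin d → G) (k : Fin (Fintype.card G)) (θ : Fin d → ℝ) :
    |bandFunction b 0 k θ| ≤ 2 * d := by
  by_contra hc
  have h1 := ncard_bandFunction_zero b θ (fun x => ¬ |x| ≤ 2 * d)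
  have h2 : {χ : AddChar G ℂ | ¬ |shiftedSymbol (characterPhase b χ) θ| ≤ 2 * d} = ∅ := by
    refine Set.eq_empty_of_forall_notMem fun χ h => h ?_
    refine (Finset.abs_sum_le_sum_abs _ _).trans
      ((Finset.sum_le_card_nsmul _ _ 2 fun i _ => ?_).trans ?_)
    · rw [abs_mul, abs_two]
      linarith [Real.abs_cos_le_one (θ i + characterPhase b χ i)]
    · simp [mul_comm]
  rw [h2, Set.ncard_empty, Set.ncard_eq_zero] at h1
  exact Set.notMem_empty k (h1 ▸ hc)

/-- A gap between consecutive free bands can only occur at `0`, and not at all if some `b j` has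
odd order. -/
theorem eq_zero_of_free_gap (hd : 2 ≤ d) (b : Fin d → G) {k k' : Fin (Fintype.card G)}
    (hk : (k' : ℕ) = k + 1) {E : ℝ} (h1 : ∀ θ, E ≤ bandFunction b 0 k θ)
    (h2 : ∀ θ, bandFunction b 0 k' θ ≤ E) :
    E = 0 ∧ ∀ (j : Fin d) (q : ℕ), q • b j = 0 → ¬ Odd q := by
  by_contra hcon
  -- Free bands lie in [-2d, 2d] and none is identically an endpoint, so a separating level is
  -- interior.
  have hE : |E| < 2 * d := by
    obtain ⟨θ, hθ⟩ := exists_forall_bandFunction_zero_ne (by omega) b (2 * d)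
    obtain ⟨θ', hθ'⟩ := exists_forall_bandFunction_zero_ne (by omega) b (-(2 * d))
    have e1 := abs_le.1 (abs_bandFunction_zero_le b k θ)
    have e2 := abs_le.1 (abs_bandFunction_zero_le b k' θ')
    rw [abs_lt]
    exact ⟨(lt_of_le_of_ne e2.1 (hθ' k').symm).trans_le (h2 θ'),
      (h1 θ).trans_lt (lt_of_le_of_ne e1.2 (hθ k))⟩
  have hcr : Crosses (characterPhase (G := G) b) E := by
    refine crosses_of_abs_lt hd _ (characterPhase_one b) hE ?_
    by_cases hE0 : E = 0
    · right
      have : ∃ (j : Fin d) (q : ℕ), q • b j = 0 ∧ Odd q := by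
        by_contra! h
        exact hcon ⟨hE0, fun j q hj => by simpa using h j q hj⟩
      obtain ⟨j, q, hj, hq⟩ := this
      exact ⟨j, fun χ => cos_characterPhase_of_odd hq hj χ⟩
    · exact Or.inl hE0
  obtain ⟨y, y', h⟩ := hcr
  rw [← ncard_bandFunction_zero b y' (· ≤ E), ← ncard_bandFunction_zero b y (· < E)] at h
  -- Any band below E somewhere has index at least `k'`, hence is at most E everywhere; this
  -- contradicts the strict count.
  refine h.not_ge (Set.ncard_le_ncard fun i (hi : _ < E) => ?_)
  have hki : k < i := by
    by_contra! hik
    exact absurd ((h1 y).trans (bandFunction_antitone b 0 y hik)) (not_le.2 hi)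
  exact (bandFunction_antitone b 0 y' (show k' ≤ i by
    rw [Fin.le_def, hk]; exact hki)).trans (h2 y')

end free

end bloch

/-! ### Bounded solutions give spectrum -/

section quasimodes

/-- The `ℓ¹` length of a lattice vector. -/
def latticeLength {d : ℕ} (n : IntLattice d) : ℕ := ∑ i, (n i).natAbs

variable {d : ℕ}

theorem latticeLength_add_le (n m : IntLattice d) :
    latticeLength (n + m) ≤ latticeLength n + latticeLength m := by
  rw [latticeLength, latticeLength, latticeLength, ← Finset.sum_add_distrib]
  exact Finset.sum_le_sum fun i _ => Int.natAbs_add_le _ _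

theorem latticeLength_neg (n : IntLattice d) : latticeLength (-n) = latticeLength n := by
  simp [latticeLength]

theorem latticeLength_single (i : Fin d) : latticeLength (Pi.single i 1 : IntLattice d) = 1 := by
  rw [latticeLength, Finset.sum_eq_single i] <;> simp +contextual

theorem summable_pow_latticeLength {r : ℝ} (h0 : 0 ≤ r) (h1 : r < 1) :
    Summable fun n : IntLattice d => r ^ latticeLength n := by
  classical
  have hs : Summable fun k : ℤ => r ^ k.natAbs := by
    refine Summable.of_nat_of_neg ?_ ?_ <;>
      simpa using summable_geometric_of_lt_one h0 h1
  refine summable_of_sum_le (c := (∑' k : ℤ, r ^ k.natAbs) ^ d) (fun n => by positivity) fun s => ?_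
  let t : Fin d → Finset ℤ := fun i => s.image fun n => n i
  have hst : s ⊆ Fintype.piFinset t := fun n hn =>
    Fintype.mem_piFinset.2 fun i => Finset.mem_image_of_mem _ hn
  calc ∑ n ∈ s, r ^ latticeLength n ≤ ∑ n ∈ Fintype.piFinset t, r ^ latticeLength n :=
        Finset.sum_le_sum_of_subset_of_nonneg hst fun _ _ _ => by positivity
    _ = ∏ i, ∑ k ∈ t i, r ^ k.natAbs := by
        rw [Finset.prod_univ_sum]
        exact Finset.sum_congr rfl fun n _ => by
          rw [latticeLength, Finset.prod_pow_eq_pow_sum]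
    _ ≤ ∏ _i : Fin d, ∑' k : ℤ, r ^ k.natAbs :=
        Finset.prod_le_prod (fun i _ => Finset.sum_nonneg fun _ _ => by positivity) fun i _ =>
          hs.sum_le_tsum _ fun _ _ => by positivity
    _ = _ := by simp

/-- The exponential cutoff varies along an edge by at most δ times its value at the neighbour. -/
theorem abs_inv_pow_sub_le {δ : ℝ} (hδ : 0 < δ) {D D' : ℕ} (h : D ≤ D' + 1) (h' : D' ≤ D + 1) :
    |(1 + δ)⁻¹ ^ D - (1 + δ)⁻¹ ^ D'| ≤ δ * (1 + δ)⁻¹ ^ D' := by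
  have hp : ∀ k : ℕ, (1 + δ)⁻¹ ^ k = (1 + δ) * (1 + δ)⁻¹ ^ (k + 1) := fun k => by
    rw [pow_succ']; field_simp
  have hpos : ∀ k : ℕ, 0 < (1 + δ)⁻¹ ^ k := fun k => by positivity
  obtain rfl | rfl | rfl : D = D' ∨ D = D' + 1 ∨ D' = D + 1 := by omega
  · rw [sub_self, abs_zero]; have := hpos D; positivity
  · rw [abs_le, hp D']
    have := hpos (D' + 1)
    constructor <;> nlinarith [mul_pos hδ this, mul_pos hδ (mul_pos hδ this)]
  · rw [abs_le, hp D]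
    have := hpos (D + 1)
    constructor <;> nlinarith [mul_pos hδ this, mul_pos hδ (mul_pos hδ this)]

/-- The plane wave with quasimomentum `θ`. -/
def planeWave (θ : Fin d → ℝ) (n : IntLattice d) : ℂ :=
  Complex.exp ((∑ i, θ i * n i : ℝ) * Complex.I)

theorem planeWave_add (θ : Fin d → ℝ) (n m : IntLattice d) :
    planeWave θ (n + m) = planeWave θ n * planeWave θ m := by
  rw [planeWave, planeWave, planeWave, ← Complex.exp_add, ← add_mul, ← Complex.ofReal_add,
    ← Finset.sum_add_distrib]
  simp only [Pi.add_apply, Int.cast_add, mul_add]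

theorem norm_planeWave (θ : Fin d → ℝ) (n : IntLattice d) : ‖planeWave θ n‖ = 1 :=
  Complex.norm_exp_ofReal_mul_I _

theorem planeWave_single (θ : Fin d → ℝ) (i : Fin d) :
    planeWave θ (Pi.single i 1) = Complex.exp (θ i * Complex.I) := by
  simp [planeWave, Pi.single_apply]

theorem planeWave_neg_single (θ : Fin d → ℝ) (i : Fin d) :
    planeWave θ (-Pi.single i 1) = Complex.exp (-(θ i * Complex.I)) := by
  simp [planeWave, Pi.single_apply]

/-- If the eigenvalue equation at `E` has a nonzero bounded solution, then `E` is in the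
spectrum. -/
theorem mem_spectrum_of_bounded_solution {V : Potential d} {E : ℂ} {ψ : IntLattice d → ℂ} {C : ℝ}
    (hC : ∀ n, ‖ψ n‖ ≤ C) {n₀ : IntLattice d} (hn₀ : ψ n₀ ≠ 0)
    (hψ : ∀ n, (∑ i : Fin d, (ψ (n + Pi.single i 1) + ψ (n - Pi.single i 1))) + V n * ψ n =
      E * ψ n) : E ∈ spectrum ℂ (schrodinger V) := by
  rw [spectrum.mem_iff]
  intro hunit
  obtain ⟨B, hB⟩ := hunit.exists_left_inv
  set A := algebraMap ℂ (EllTwo d →L[ℂ] EllTwo d) E - schrodinger V with hA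
  -- The function u is ψ cut off by (1 + δ)^(-|n|). Then (E - H_V)u is bounded pointwise by δ times
  -- the Laplacian of |u|, so a left inverse B gives ‖u‖ ≤ δK‖u‖; the choice δ = 1/(K + 1) makes
  -- this impossible.
  set K : ℝ := ‖B‖ * ‖schrodinger (0 : Potential d)‖ with hK
  have hK0 : 0 ≤ K := by positivity
  let δ : ℝ := (K + 1)⁻¹
  have hδ : 0 < δ := by positivity
  have hδK : δ * K < 1 := by
    rw [inv_mul_lt_iff₀ (by positivity)]; linarith
  have hr1 : (1 + δ)⁻¹ < 1 := inv_lt_one_of_one_lt₀ (by linarith)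
  let χ : IntLattice d → ℝ := fun n => (1 + δ)⁻¹ ^ latticeLength n
  have hχ : ∀ n, 0 < χ n := fun n => by positivity
  have hmem : Memℓp (fun n => (χ n : ℂ) * ψ n) 2 := by
    refine Memℓp.of_exponent_ge (q := 1) (memℓp_gen ?_) (by norm_num)
    refine Summable.of_nonneg_of_le (fun _ => by positivity) (fun n => ?_)
      ((summable_pow_latticeLength (by positivity) hr1).mul_right C)
    rw [ENNReal.toReal_one, Real.rpow_one, norm_mul, Complex.norm_real, Real.norm_of_nonneg (hχ n).le]
    exact mul_le_mul_of_nonneg_left (hC n) (hχ n).le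
  let u : EllTwo d := ⟨_, hmem⟩
  have hu : ∀ n, u n = χ n * ψ n := fun n => rfl
  have hmem' : Memℓp (fun n => ((‖u n‖ : ℝ) : ℂ)) 2 := by
    refine memℓp_gen ?_
    have := (lp.memℓp u).summable (by norm_num)
    simpa only [Complex.norm_real, norm_norm] using this
  let f : EllTwo d := ⟨_, hmem'⟩
  have hf : ∀ n, f n = (‖u n‖ : ℝ) := fun n => rfl
  have hfu : ‖f‖ ≤ ‖u‖ := lp.norm_mono (by norm_num) fun n => by simp [hf]
  have hstep : ∀ n m : IntLattice d, latticeLength m = 1 →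
      ‖((χ n : ℂ) - χ (n + m)) * ψ (n + m)‖ ≤ δ * ‖u (n + m)‖ := by
    intro n m hm
    rw [hu, norm_mul, norm_mul, ← mul_assoc, ← Complex.ofReal_sub, Complex.norm_real,
      Complex.norm_real, Real.norm_of_nonneg (hχ _).le]
    refine mul_le_mul_of_nonneg_right (abs_inv_pow_sub_le hδ ?_ ?_) (norm_nonneg _)
    · have := latticeLength_add_le (n + m) (-m)
      rwa [latticeLength_neg, hm, add_neg_cancel_right] at this
    · have := latticeLength_add_le n m
      rwa [hm] at this
  have hAu : ∀ n, A u n = ∑ i, (((χ n : ℂ) - χ (n + Pi.single i 1)) * ψ (n + Pi.single i 1) +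
      ((χ n : ℂ) - χ (n + -Pi.single i 1)) * ψ (n + -Pi.single i 1)) := by
    intro n
    have e1 : A u n = E * u n - schrodinger V u n := by
      rw [hA, Algebra.algebraMap_eq_smul_one]
      rfl
    rw [e1, schrodinger_apply]
    simp only [hu, ← sub_eq_add_neg]
    have e2 : E * (χ n * ψ n) = χ n * (E * ψ n) := by ring
    rw [e2, ← hψ n, mul_add, Finset.mul_sum, mul_left_comm, add_sub_add_right_eq_sub,
      ← Finset.sum_sub_distrib]
    exact Finset.sum_congr rfl fun i _ => by ring
  have hbound : ‖A u‖ ≤ ‖(δ : ℂ) • schrodinger (0 : Potential d) f‖ := by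
    refine lp.norm_mono (by norm_num) fun n => ?_
    have e : ((δ : ℂ) • schrodinger (0 : Potential d) f) n =
        ((δ * ∑ i : Fin d, (‖u (n + Pi.single i 1)‖ + ‖u (n + -Pi.single i 1)‖) : ℝ) : ℂ) := by
      rw [lp.coeFn_smul, Pi.smul_apply, schrodinger_apply]
      simp [hf, sub_eq_add_neg]
    rw [e, Complex.norm_real, Real.norm_of_nonneg (by positivity), hAu, Finset.mul_sum]
    refine norm_sum_le_of_le _ fun i _ => (norm_add_le _ _).trans ?_
    rw [mul_add]
    exact add_le_add (hstep _ _ (latticeLength_single i))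
      (hstep _ _ (by rw [latticeLength_neg, latticeLength_single]))
  have hu0 : 0 < ‖u‖ := by
    rw [norm_pos_iff]
    intro h
    have : u n₀ = 0 := by rw [h]; rfl
    rw [hu] at this
    exact mul_ne_zero (by exact_mod_cast (hχ n₀).ne') hn₀ this
  have hBu : B (A u) = u := by
    have := congrArg (fun T : EllTwo d →L[ℂ] EllTwo d => T u) hB
    simpa using this
  have : ‖u‖ ≤ δ * K * ‖u‖ := calc
    ‖u‖ = ‖B (A u)‖ := by rw [hBu]
    _ ≤ ‖B‖ * ‖A u‖ := B.le_opNorm _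
    _ ≤ ‖B‖ * (δ * (‖schrodinger (0 : Potential d)‖ * ‖u‖)) := by
        refine mul_le_mul_of_nonneg_left (hbound.trans ?_) (norm_nonneg _)
        rw [norm_smul, Complex.norm_real, Real.norm_of_nonneg hδ.le]
        refine mul_le_mul_of_nonneg_left ?_ hδ.le
        exact (ContinuousLinearMap.le_opNorm _ _).trans
          (mul_le_mul_of_nonneg_left hfu (norm_nonneg _))
    _ = δ * K * ‖u‖ := by rw [hK]; ring
  nlinarith

variable {G : Type*} [AddCommGroup G] [Fintype G]

/-- An eigenvector of the fibre, pulled back to the lattice and multiplied by a plane wave, is a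
bounded solution. -/
theorem mem_spectrum_of_blochOperator {π : IntLattice d →+ G} (hπ : Function.Surjective π)
    {V : Potential d} {v : G → ℝ} (hV : ∀ n, V n = v (π n)) {θ : Fin d → ℝ} {E : ℂ}
    {w : EuclideanSpace ℂ G} (hw : w ≠ 0)
    (hE : blochOperator (fun i => π (Pi.single i 1)) v θ w = E • w) :
    E ∈ spectrum ℂ (schrodinger V) := by
  obtain ⟨g, hg⟩ : ∃ g, w g ≠ 0 := by
    by_contra! h
    exact hw (by ext g; simpa using h g)
  obtain ⟨n₀, rfl⟩ := hπ g
  refine mem_spectrum_of_bounded_solution (ψ := fun n => planeWave θ n * w (π n)) (C := ‖w‖)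
    (n₀ := n₀) (fun n => ?_) ?_ fun n => ?_
  · rw [norm_mul, norm_planeWave, one_mul]
    exact PiLp.norm_apply_le w _
  · refine mul_ne_zero (fun h => ?_) hg
    have := norm_planeWave θ n₀
    rw [h, norm_zero] at this
    exact zero_ne_one this
  · have := congrArg (fun x : EuclideanSpace ℂ G => planeWave θ n * x (π n)) hE
    simp only [blochOperator_apply, PiLp.smul_apply, smul_eq_mul] at this
    rw [mul_left_comm E, ← this, mul_add, Finset.mul_sum, hV]
    congr 1
    · refine Finset.sum_congr rfl fun i _ => ?_
      rw [sub_eq_add_neg n, planeWave_add, planeWave_add, planeWave_single, planeWave_neg_single,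
        map_add, map_add, map_neg, ← sub_eq_add_neg]
      ring
    · ring

end quasimodes

/-! ### The Bloch transform and the spectrum as a union of bands -/

section floquet

variable {d : ℕ}

theorem translation_single (v n : IntLattice d) :
    translation v (lp.single 2 n (1 : ℂ)) = lp.single 2 (n - v) (1 : ℂ) := by
  ext m
  simp only [translation_apply, lp.single_apply, Pi.single_apply, eq_sub_iff_add_eq]

theorem multiplication_apply (V : Potential d) (u : EllTwo d) (n : IntLattice d) :
    multiplication V u n = (V n : ℂ) * u n := rfl

theorem multiplication_single (V : Potential d) (n : IntLattice d) :
    multiplication V (lp.single 2 n (1 : ℂ)) = (V n : ℂ) • lp.single 2 n (1 : ℂ) := by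
  ext m
  rw [multiplication_apply, lp.coeFn_smul, Pi.smul_apply, smul_eq_mul]
  by_cases h : m = n
  · rw [h]
  · rw [lp.single_apply_ne _ _ _ h, mul_zero, mul_zero]

theorem inner_translation_left (v : IntLattice d) (x y : EllTwo d) :
    ⟪translation v x, y⟫_ℂ = ⟪x, translation (-v) y⟫_ℂ := by
  rw [lp.inner_eq_tsum, lp.inner_eq_tsum,
    ← Equiv.tsum_eq (Equiv.addRight v) fun n => ⟪x n, translation (-v) y n⟫_ℂ]
  simp

theorem schrodinger_isSymmetric (V : Potential d) :
    (schrodinger V : EllTwo d →ₗ[ℂ] EllTwo d).IsSymmetric := by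
  intro x y
  have hm : ⟪multiplication V x, y⟫_ℂ = ⟪x, multiplication V y⟫_ℂ := by
    rw [lp.inner_eq_tsum, lp.inner_eq_tsum]
    refine tsum_congr fun n => ?_
    simp only [multiplication_apply, RCLike.inner_apply, map_mul, Complex.conj_ofReal]
    ring
  simp only [ContinuousLinearMap.coe_coe, schrodinger, latticeLaplacian, add_apply, sum_apply,
    inner_add_left, inner_add_right, sum_inner, inner_sum, inner_translation_left, neg_neg, hm]
  congr 1
  exact Finset.sum_congr rfl fun i _ => add_comm _ _

/-- Finitely supported functions inside `ℓ²`. -/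
def finsuppToEllTwo (d : ℕ) : (IntLattice d →₀ ℂ) →ₗ[ℂ] EllTwo d :=
  Finsupp.linearCombination ℂ fun n => lp.single 2 n (1 : ℂ)

/-- The discrete Schrödinger operator on finitely supported functions. -/
def finsuppSchrodinger (V : Potential d) : (IntLattice d →₀ ℂ) →ₗ[ℂ] (IntLattice d →₀ ℂ) :=
  Finsupp.linearCombination ℂ fun n =>
    ∑ i, (Finsupp.single (n - Pi.single i 1) 1 + Finsupp.single (n + Pi.single i 1) 1) +
      (V n : ℂ) • Finsupp.single n 1

theorem finsuppToEllTwo_single (n : IntLattice d) :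
    finsuppToEllTwo d (Finsupp.single n 1) = lp.single 2 n (1 : ℂ) := by
  simp [finsuppToEllTwo]

theorem finsuppToEllTwo_schrodinger (V : Potential d) (u : IntLattice d →₀ ℂ) :
    finsuppToEllTwo d (finsuppSchrodinger V u) = schrodinger V (finsuppToEllTwo d u) := by
  have : finsuppToEllTwo d ∘ₗ finsuppSchrodinger V =
      (schrodinger V : EllTwo d →ₗ[ℂ] EllTwo d) ∘ₗ finsuppToEllTwo d := by
    refine Finsupp.lhom_ext' fun n => LinearMap.ext_ring ?_
    simp only [LinearMap.comp_apply, Finsupp.lsingle_apply, finsuppToEllTwo_single,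
      ContinuousLinearMap.coe_coe, schrodinger, latticeLaplacian, add_apply, sum_apply,
      translation_single, multiplication_single, sub_neg_eq_add]
    rw [finsuppSchrodinger, Finsupp.linearCombination_single, one_smul]
    simp only [map_add, map_sum, map_smul, finsuppToEllTwo_single]
  exact LinearMap.congr_fun this u

theorem norm_sq_finsuppToEllTwo (u : IntLattice d →₀ ℂ) :
    ‖finsuppToEllTwo d u‖ ^ 2 = ∑ n ∈ u.support, ‖u n‖ ^ 2 := by
  have h := lp.norm_sum_single (p := 2) (E := fun _ : IntLattice d => ℂ) (by norm_num)
    (fun n => u n) u.support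
  have e : finsuppToEllTwo d u = ∑ n ∈ u.support, lp.single 2 n (u n) := by
    rw [finsuppToEllTwo, Finsupp.linearCombination_apply, Finsupp.sum]
    refine Finset.sum_congr rfl fun n _ => ?_
    rw [← lp.single_smul, smul_eq_mul, mul_one]
  rw [e]
  simpa using h

theorem denseRange_finsuppToEllTwo (d : ℕ) : DenseRange (finsuppToEllTwo d) := by
  intro f
  refine mem_closure_of_tendsto (lp.hasSum_single (p := 2) (by norm_num) f)
    (Eventually.of_forall fun s => ⟨∑ n ∈ s, Finsupp.single n (f n), ?_⟩)
  rw [map_sum]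
  refine Finset.sum_congr rfl fun n _ => ?_
  rw [finsuppToEllTwo, Finsupp.linearCombination_single, ← lp.single_smul, smul_eq_mul, mul_one]

section transform

variable {G : Type*} [AddCommGroup G] [Fintype G]

open Classical in
/-- The Bloch transform at quasimomentum `θ` of a finitely supported function. -/
def blochTransform (π : IntLattice d →+ G) (θ : Fin d → ℝ) :
    (IntLattice d →₀ ℂ) →ₗ[ℂ] EuclideanSpace ℂ G :=
  Finsupp.linearCombination ℂ fun n => planeWave θ (-n) • EuclideanSpace.single (π n) 1

open Classical in
theorem blochTransform_single (π : IntLattice d →+ G) (θ : Fin d → ℝ) (n : IntLattice d) :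
    blochTransform π θ (Finsupp.single n 1) =
      planeWave θ (-n) • EuclideanSpace.single (π n) 1 := by
  simp [blochTransform]

open Classical in
theorem groupShift_single (g m : G) :
    groupShift g (EuclideanSpace.single m (1 : ℂ)) = EuclideanSpace.single (m - g) 1 := by
  ext k
  simp only [groupShift_apply, PiLp.single_apply, eq_sub_iff_add_eq]

open Classical in
theorem groupMultiplication_single (v : G → ℝ) (m : G) :
    groupMultiplication v (EuclideanSpace.single m (1 : ℂ)) =
      (v m : ℂ) • EuclideanSpace.single m 1 := by
  ext k
  rw [groupMultiplication_apply, PiLp.smul_apply, PiLp.single_apply, smul_eq_mul]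
  by_cases h : k = m <;> simp [h]

theorem blochTransform_schrodinger {π : IntLattice d →+ G} {V : Potential d} {v : G → ℝ}
    (hV : ∀ n, V n = v (π n)) (θ : Fin d → ℝ) (u : IntLattice d →₀ ℂ) :
    blochTransform π θ (finsuppSchrodinger V u) =
      blochOperator (fun i => π (Pi.single i 1)) v θ (blochTransform π θ u) := by
  classical
  have : blochTransform π θ ∘ₗ finsuppSchrodinger V =
      (blochOperator (fun i => π (Pi.single i 1)) v θ :
        EuclideanSpace ℂ G →ₗ[ℂ] EuclideanSpace ℂ G) ∘ₗ blochTransform π θ := by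
    refine Finsupp.lhom_ext' fun n => LinearMap.ext_ring ?_
    simp only [LinearMap.comp_apply, Finsupp.lsingle_apply, blochTransform_single,
      ContinuousLinearMap.coe_coe, map_smul, blochOperator, add_apply, sum_apply, smul_apply,
      groupShift_single, groupMultiplication_single]
    rw [finsuppSchrodinger, Finsupp.linearCombination_single, one_smul]
    simp only [map_add, map_sum, map_smul, blochTransform_single, smul_add, Finset.smul_sum]
    congr 1
    · refine Finset.sum_congr rfl fun i _ => ?_
      rw [neg_sub, sub_eq_add_neg (Pi.single i 1), planeWave_add, neg_add, planeWave_add,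
        planeWave_single, planeWave_neg_single, smul_smul, smul_smul, sub_neg_eq_add, map_sub,
        mul_comm (Complex.exp (θ i * Complex.I))]
    · rw [hV, smul_comm]
  exact LinearMap.congr_fun this u

/-- The points of a uniform grid of quasimomenta. -/
def gridPoint (d N : ℕ) (k : Fin d → Fin N) (i : Fin d) : ℝ := 2 * Real.pi * (k i : ℕ) / N

/-- The sum factors into geometric sums. In a coordinate with 0 < |m_j| < N the ratio is an N-th
root of unity other than 1, so that factor vanishes. -/
theorem sum_planeWave_gridPoint {N : ℕ} {m : IntLattice d} (hm : m ≠ 0)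
    (hN : ∀ i, (m i).natAbs < N) : ∑ k, planeWave (gridPoint d N k) m = 0 := by
  obtain ⟨j, hj⟩ := Function.ne_iff.1 hm
  have hN0 : (N : ℂ) ≠ 0 := by
    have := hN j
    exact_mod_cast (by omega : N ≠ 0)
  let ζ : Fin d → ℂ := fun i => Complex.exp (2 * Real.pi * m i / N * Complex.I)
  have h1 : ∀ k : Fin d → Fin N, planeWave (gridPoint d N k) m = ∏ i, ζ i ^ (k i : ℕ) := by
    intro k
    rw [planeWave, Complex.ofReal_sum, Finset.sum_mul, Complex.exp_sum]
    refine Finset.prod_congr rfl fun i _ => ?_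
    rw [← Complex.exp_nat_mul, gridPoint]
    congr 1
    push_cast
    ring
  have h2 : ∑ k : Fin d → Fin N, ∏ i, ζ i ^ (k i : ℕ) = ∏ i, ∑ l : Fin N, ζ i ^ (l : ℕ) := by
    rw [Finset.prod_univ_sum, Fintype.piFinset_univ]
  rw [Finset.sum_congr rfl fun k _ => h1 k, h2]
  refine Finset.prod_eq_zero (Finset.mem_univ j) ?_
  rw [Fin.sum_univ_eq_sum_range fun l => ζ j ^ l]
  have hζN : ζ j ^ N = 1 := by
    rw [← Complex.exp_nat_mul, Complex.exp_eq_one_iff]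
    exact ⟨m j, by field_simp⟩
  have hζ1 : ζ j ≠ 1 := by
    intro h
    obtain ⟨t, ht⟩ := Complex.exp_eq_one_iff.1 h
    have h3 : (m j : ℂ) = t * N := by
      have hpi : (2 * Real.pi * Complex.I : ℂ) ≠ 0 := Complex.two_pi_I_ne_zero
      field_simp at ht
      have : (2 * Real.pi * Complex.I : ℂ) * m j = (2 * Real.pi * Complex.I) * (t * N) := by
        linear_combination (2 * Real.pi * Complex.I) * ht
      exact mul_left_cancel₀ hpi this
    have h4 : m j = t * N := by exact_mod_cast h3
    have h5 := Int.eq_zero_of_dvd_of_natAbs_lt_natAbs (Dvd.intro_left t h4.symm)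
      (by simpa using hN j)
    exact hj h5
  have := mul_neg_geom_sum (ζ j) N
  rw [hζN, sub_self, mul_eq_zero] at this
  exact this.resolve_left (sub_ne_zero.2 hζ1.symm)

theorem planeWave_zero (θ : Fin d → ℝ) : planeWave θ 0 = 1 := by simp [planeWave]

theorem conj_planeWave (θ : Fin d → ℝ) (n : IntLattice d) :
    (starRingEnd ℂ) (planeWave θ n) = planeWave θ (-n) := by
  rw [planeWave, conj_exp_mul_I, planeWave]
  congr 1
  simp

/-- A Parseval identity: averaging over a fine grid of quasimomenta recovers the `ℓ²` norm. -/
theorem sum_norm_sq_blochTransform (π : IntLattice d →+ G) {N : ℕ} (u : IntLattice d →₀ ℂ)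
    (hN : ∀ n ∈ u.support, ∀ m ∈ u.support, ∀ i, (m i - n i).natAbs < N) :
    ∑ k, ‖blochTransform π (gridPoint d N k) u‖ ^ 2 =
      (N : ℝ) ^ d * ‖finsuppToEllTwo d u‖ ^ 2 := by
  classical
  rw [norm_sq_finsuppToEllTwo]
  apply Complex.ofReal_injective
  have h1 : ∀ θ, ((‖blochTransform π θ u‖ ^ 2 : ℝ) : ℂ) =
      ∑ n ∈ u.support, ∑ m ∈ u.support, (starRingEnd ℂ) (u n) * u m *
        (if π n = π m then 1 else 0) * planeWave θ (n - m) := by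
    intro θ
    have e : blochTransform π θ u = ∑ n ∈ u.support,
        u n • planeWave θ (-n) • EuclideanSpace.single (π n) (1 : ℂ) := by
      rw [blochTransform, Finsupp.linearCombination_apply, Finsupp.sum]
    have e' : ((‖blochTransform π θ u‖ ^ 2 : ℝ) : ℂ) =
        ⟪blochTransform π θ u, blochTransform π θ u⟫_ℂ := by
      rw [inner_self_eq_norm_sq_to_K, Complex.ofReal_pow]
      rfl
    rw [e', e, sum_inner]
    refine Finset.sum_congr rfl fun n _ => ?_
    rw [inner_sum]
    refine Finset.sum_congr rfl fun m _ => ?_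
    rw [inner_smul_left, inner_smul_left, inner_smul_right, inner_smul_right,
      EuclideanSpace.inner_single_left, PiLp.single_apply, conj_planeWave, neg_neg,
      sub_eq_add_neg, planeWave_add, map_one, one_mul]
    ring
  rw [Complex.ofReal_sum, Finset.sum_congr rfl fun k _ => h1 _, Finset.sum_comm]
  rw [Complex.ofReal_mul, Complex.ofReal_sum, Finset.mul_sum]
  refine Finset.sum_congr rfl fun n hn => ?_
  rw [Finset.sum_comm, Finset.sum_eq_single n]
  · simp only [sub_self, planeWave_zero, if_true, mul_one, Finset.sum_const, Finset.card_univ,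
      Fintype.card_pi, Fintype.card_fin, Finset.prod_const, nsmul_eq_mul]
    rw [mul_comm ((starRingEnd ℂ) (u n)), Complex.mul_conj, Complex.normSq_eq_norm_sq]
    push_cast
    ring
  · intro m hm hmn
    rw [← Finset.mul_sum, sum_planeWave_gridPoint (sub_ne_zero.2 hmn.symm)
      fun i => hN m hm n hn i, mul_zero]
  · exact fun h => absurd hn h

theorem exists_grid_bound (u w : IntLattice d →₀ ℂ) : ∃ N : ℕ, 0 < N ∧
    (∀ n ∈ u.support, ∀ m ∈ u.support, ∀ i, (m i - n i).natAbs < N) ∧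
    ∀ n ∈ w.support, ∀ m ∈ w.support, ∀ i, (m i - n i).natAbs < N := by
  classical
  let s := u.support ∪ w.support
  let N := ∑ n ∈ s, latticeLength n
  have h : ∀ n ∈ s, ∀ i, (n i).natAbs ≤ N := fun n hn i =>
    (Finset.single_le_sum (f := fun i => (n i).natAbs) (fun _ _ => Nat.zero_le _)
      (Finset.mem_univ i)).trans
      (Finset.single_le_sum (f := latticeLength) (fun _ _ => Nat.zero_le _) hn)
  refine ⟨2 * N + 1, by omega, fun n hn m hm i => ?_, fun n hn m hm i => ?_⟩
  · have h1 := h n (Finset.mem_union_left _ hn) i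
    have h2 := h m (Finset.mem_union_left _ hm) i
    omega
  · have h1 := h n (Finset.mem_union_right _ hn) i
    have h2 := h m (Finset.mem_union_right _ hm) i
    omega

/-- By density x may be taken finitely supported. A finite grid finer than the supports then gives
an exact Parseval identity, and the bound holds fibre by fibre, with no integral over θ. -/
theorem le_norm_schrodinger_sub_smul {π : IntLattice d →+ G} {V : Potential d} {v : G → ℝ}
    (hV : ∀ n, V n = v (π n)) {E c : ℝ} (hc : 0 ≤ c)
    (h : ∀ k θ, c ≤ |bandFunction (fun i => π (Pi.single i 1)) v k θ - E|) (x : EllTwo d) :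
    c * ‖x‖ ≤ ‖schrodinger V x - (E : ℂ) • x‖ := by
  refine (denseRange_finsuppToEllTwo d).induction_on x
    (isClosed_le (by fun_prop) (by fun_prop)) fun u => ?_
  let w := finsuppSchrodinger V u - (E : ℂ) • u
  have hw : schrodinger V (finsuppToEllTwo d u) - (E : ℂ) • finsuppToEllTwo d u =
      finsuppToEllTwo d w := by
    rw [map_sub, map_smul, finsuppToEllTwo_schrodinger]
  rw [hw]
  obtain ⟨N, hN, hu, hw⟩ := exists_grid_bound u w
  refine (sq_le_sq₀ (by positivity) (norm_nonneg _)).1 ?_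
  have hNd : (0 : ℝ) < (N : ℝ) ^ d := by positivity
  refine le_of_mul_le_mul_left ?_ hNd
  rw [← sum_norm_sq_blochTransform π w hw, mul_pow, mul_left_comm,
    ← sum_norm_sq_blochTransform π u hu, Finset.mul_sum]
  refine Finset.sum_le_sum fun k _ => ?_
  rw [← mul_pow]
  refine pow_le_pow_left₀ (by positivity) ?_ 2
  rw [map_sub, map_smul, blochTransform_schrodinger hV]
  exact (blochOperator_isSymmetric _ v _).le_norm_apply_sub_smul finrank_euclideanSpace hc
    (fun i => h i _) _

/-- The spectrum of a periodic discrete Schrödinger operator is the union of its bands. -/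
theorem spectrum_schrodinger {π : IntLattice d →+ G} (hπ : Function.Surjective π)
    {V : Potential d} {v : G → ℝ} (hV : ∀ n, V n = v (π n)) :
    spectrum ℂ (schrodinger V) = Complex.ofReal ''
      ⋃ k, Set.range (bandFunction (fun i => π (Pi.single i 1)) v k) := by
  ext z
  constructor
  · intro hz
    have hsa : IsSelfAdjoint (schrodinger V) :=
      ContinuousLinearMap.isSelfAdjoint_iff_isSymmetric.2 (schrodinger_isSymmetric V)
    have hre := hsa.mem_spectrum_eq_re hz
    refine ⟨z.re, ?_, hre.symm⟩
    by_contra hmem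
    set E := z.re
    have hclosed :
        IsClosed (⋃ k, Set.range (bandFunction (fun i => π (Pi.single i 1)) v k)) := by
      refine isClosed_iUnion_of_finite fun k => ?_
      obtain ⟨l, r, h⟩ := range_bandFunction (fun i => π (Pi.single i 1)) v k
      rw [h]
      exact isClosed_Icc
    obtain ⟨c, hc, hball⟩ := Metric.isOpen_iff.1 hclosed.isOpen_compl E hmem
    have hbelow := le_norm_schrodinger_sub_smul hV (E := E) hc.le fun k θ => by
      by_contra! hlt
      exact hball (Metric.mem_ball.2 ((Real.dist_eq _ _).trans_lt hlt))
        (Set.mem_iUnion.2 ⟨k, θ, rfl⟩)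
    let f : EllTwo d →L[ℂ] EllTwo d := schrodinger V - (E : ℂ) • 1
    have hf : ∀ x, f x = schrodinger V x - (E : ℂ) • x := fun x => rfl
    have hfsym : ∀ x y, ⟪f x, y⟫_ℂ = ⟪x, f y⟫_ℂ := fun x y => by
      rw [hf, hf, inner_sub_left, inner_sub_right, inner_smul_left, inner_smul_right,
        Complex.conj_ofReal]
      congr 1
      exact schrodinger_isSymmetric V x y
    -- By symmetry ⟪f²x, x⟫ = ‖f x‖² ≥ c²‖x‖², so f² is coercive and invertible, and therefore so is
    -- f.
    have hunit : IsUnit (f ^ 2) := by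
      refine ContinuousLinearMap.isUnit_of_forall_le_norm_inner_map (f ^ 2)
        (c := ⟨c ^ 2, by positivity⟩) (by exact_mod_cast (by positivity : 0 < c ^ 2))
        fun x => ?_
      have e : ⟪(f ^ 2) x, x⟫_ℂ = ⟪f x, f x⟫_ℂ := by
        rw [pow_two, mul_apply_eq_comp, hfsym]
      rw [e, inner_self_eq_norm_sq_to_K, norm_pow, RCLike.norm_ofReal, abs_norm]
      change ‖x‖ ^ 2 * c ^ 2 ≤ _
      rw [← mul_pow, mul_comm, hf]
      exact pow_le_pow_left₀ (by positivity) (hbelow x) 2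
    have hunit' : IsUnit f := (isUnit_pow_iff two_ne_zero).1 hunit
    rw [spectrum.mem_iff] at hz
    refine hz ?_
    have : algebraMap ℂ (EllTwo d →L[ℂ] EllTwo d) z - schrodinger V = -f := by
      rw [Algebra.algebraMap_eq_smul_one, hre, neg_sub]
    rw [this]
    exact hunit'.neg
  · rintro ⟨E, hE, rfl⟩
    obtain ⟨k, θ, rfl⟩ := Set.mem_iUnion.1 hE
    set T := blochOperator_isSymmetric (fun i => π (Pi.single i 1)) v θ
    exact mem_spectrum_of_blochOperator hπ hV
      ((T.eigenvectorBasis finrank_euclideanSpace).orthonormal.ne_zero k)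
      (T.apply_eigenvectorBasis finrank_euclideanSpace k)

end transform

end floquet

/-! ### Gluing bands into intervals -/

section bands

variable {d : ℕ}

/-- A chain of successively overlapping intervals with ordered endpoints covers an interval. -/
theorem biUnion_Icc_eq_of_overlap {n : ℕ} {l r : Fin n → ℝ} (hl : Antitone l) (hr : Antitone r)
    {p m : Fin n} (hpm : p ≤ m)
    (h : ∀ j j' : Fin n, (j' : ℕ) = j + 1 → p ≤ j → j' ≤ m → l j ≤ r j') :
    ⋃ j ∈ Set.Icc p m, Set.Icc (l j) (r j) = Set.Icc (l m) (r p) := by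
  classical
  refine Set.Subset.antisymm (Set.iUnion₂_subset fun j hj =>
    Set.Icc_subset_Icc (hl hj.2) (hr hj.1)) fun x hx => ?_
  -- The last interval whose right end is at least x contains x: otherwise x lies left of it, and
  -- the overlap makes the next index qualify too.
  let s : Finset (Fin n) := (Finset.Icc p m).filter fun j => x ≤ r j
  have hs : s.Nonempty := ⟨p, by simp [s, hpm, hx.2]⟩
  have hj := s.max'_mem hs
  set j := s.max' hs
  obtain ⟨hj1, hj2⟩ := Finset.mem_filter.1 hj
  rw [Finset.mem_Icc] at hj1
  refine Set.mem_iUnion₂.2 ⟨j, hj1, ?_, hj2⟩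
  rcases hj1.2.eq_or_lt with hjm | hjm
  · rw [hjm]; exact hx.1
  · have hlt : (j : ℕ) + 1 < n := by
      have := m.2
      have : (j : ℕ) < m := hjm
      omega
    let j' : Fin n := ⟨j + 1, hlt⟩
    have hj'm : j' ≤ m := by
      have : (j : ℕ) < m := hjm
      exact this
    have hjj' : j < j' := Nat.lt_succ_self (j : ℕ)
    by_contra! hxl
    have hmem : j' ∈ s := Finset.mem_filter.2
      ⟨Finset.mem_Icc.2 ⟨hj1.1.trans hjj'.le, hj'm⟩, (hxl.trans_le (h j j' rfl hj1.1 hj'm)).le⟩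
    exact absurd (s.le_max' j' hmem) (not_le.2 hjj')

variable {G : Type*} [AddCommGroup G] [Fintype G]

theorem eventually_bandFunction_lt {b : Fin d → G} {k k' : Fin (Fintype.card G)}
    {θ θ' : Fin d → ℝ} (h : bandFunction b 0 k θ < bandFunction b 0 k' θ') :
    ∀ᶠ c in 𝓝[>] (0 : ℝ), ∀ v : G → ℝ, (∀ m, |v m| ≤ c) →
      bandFunction b v k θ < bandFunction b v k' θ' := by
  have hpos : 0 < (bandFunction b 0 k' θ' - bandFunction b 0 k θ) / 2 := by linarith
  filter_upwards [Ioo_mem_nhdsGT hpos] with c hc v hv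
  have h1 := abs_le.1 (abs_bandFunction_sub_zero_le b hv k θ)
  have h2 := abs_le.1 (abs_bandFunction_sub_zero_le b hv k' θ')
  have h3 := hc.2
  linarith [h1.2, h2.1]

theorem exists_bandFunction_zero_lt (hd : 0 < d) (b : Fin d → G) (k : Fin (Fintype.card G)) :
    ∃ θ θ', bandFunction b 0 k θ < bandFunction b 0 k θ' := by
  obtain ⟨θ, hθ⟩ := exists_forall_bandFunction_zero_ne hd b (bandFunction b 0 k 0)
  rcases lt_or_gt_of_ne (hθ k) with h | h
  · exact ⟨_, _, h⟩
  · exact ⟨_, _, h⟩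

/-- The free bands `k` and `k'` overlap in more than a point. -/
def FreeOverlap (b : Fin d → G) (k k' : Fin (Fintype.card G)) : Prop :=
  ∃ θ θ', bandFunction b 0 k θ < bandFunction b 0 k' θ'

/-- The maximum of the lower band separates the two bands, so `eq_zero_of_free_gap` forces it to be
0. -/
theorem sign_of_not_freeOverlap (hd : 2 ≤ d) {b : Fin d → G} {k k' : Fin (Fintype.card G)}
    (hk : (k' : ℕ) = k + 1) (h : ¬ FreeOverlap b k k') :
    (∀ θ, 0 ≤ bandFunction b 0 k θ) ∧ (∀ θ, bandFunction b 0 k' θ ≤ 0) ∧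
      ∀ (j : Fin d) (q : ℕ), q • b j = 0 → ¬ Odd q := by
  have h : ∀ θ θ', bandFunction b 0 k' θ' ≤ bandFunction b 0 k θ := by
    simpa [FreeOverlap] using h
  obtain ⟨l, r, hlr⟩ := range_bandFunction b 0 k'
  have h0 : bandFunction b 0 k' 0 ∈ Set.Icc l r := hlr ▸ Set.mem_range_self _
  obtain ⟨θ₁, hθ₁⟩ : r ∈ Set.range (bandFunction b 0 k') :=
    hlr ▸ Set.right_mem_Icc.2 (h0.1.trans h0.2)
  have h1 : ∀ θ, r ≤ bandFunction b 0 k θ := fun θ => hθ₁ ▸ h θ θ₁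
  have h2 : ∀ θ, bandFunction b 0 k' θ ≤ r := fun θ => by
    have : bandFunction b 0 k' θ ∈ Set.Icc l r := hlr ▸ Set.mem_range_self _
    exact this.2
  obtain ⟨rfl, hodd⟩ := eq_zero_of_free_gap hd b hk h1 h2
  exact ⟨h1, h2, hodd⟩

/-- If k < j, band j would be ≤ 0 because of the first failure and ≥ 0 because of the second, hence
constant. By symmetry at most one consecutive pair fails to overlap. -/
theorem le_of_not_freeOverlap (hd : 2 ≤ d) {b : Fin d → G} {k k' j j' : Fin (Fintype.card G)}
    (hk : (k' : ℕ) = k + 1) (h : ¬ FreeOverlap b k k') (hj : (j' : ℕ) = j + 1)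
    (h' : ¬ FreeOverlap b j j') : j ≤ k := by
  by_contra! hlt
  have h1 := (sign_of_not_freeOverlap hd hk h).2.1
  have h2 := (sign_of_not_freeOverlap hd hj h').1
  have hle : k' ≤ j := by
    rw [Fin.le_def, hk]; exact hlt
  obtain ⟨θ, hθ⟩ := exists_forall_bandFunction_zero_ne (by omega) b 0
  exact hθ j (le_antisymm ((bandFunction_antitone b 0 θ hle).trans (h1 θ)) (h2 θ))

/-- For small potentials the bands fill at most two intervals, and only one if some `b j` has odd
order. -/
theorem exists_bands_union (hd : 2 ≤ d) (b : Fin d → G) : ∃ c : ℝ, 0 < c ∧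
    ∀ v : G → ℝ, (∀ m, |v m| ≤ c) →
      (∃ a₁ b₁ a₂ b₂ : ℝ, a₁ < b₁ ∧ a₂ < b₂ ∧
        ⋃ k, Set.range (bandFunction b v k) = Set.Icc a₁ b₁ ∪ Set.Icc a₂ b₂) ∧
      ((∃ (j : Fin d) (q : ℕ), q • b j = 0 ∧ Odd q) →
        ∃ a₁ b₁ : ℝ, a₁ < b₁ ∧ ⋃ k, Set.range (bandFunction b v k) = Set.Icc a₁ b₁) := by
  -- Only finitely many strict inequalities between free bands must survive, so a single c works for
  -- all v.
  have hsmall1 : ∀ᶠ c in 𝓝[>] (0 : ℝ), ∀ k, ∀ v : G → ℝ, (∀ m, |v m| ≤ c) →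
      ∃ θ θ', bandFunction b v k θ < bandFunction b v k θ' := by
    rw [eventually_all]
    intro k
    obtain ⟨θ, θ', h⟩ := exists_bandFunction_zero_lt (by omega) b k
    filter_upwards [eventually_bandFunction_lt h] with c hc v hv
    exact ⟨θ, θ', hc v hv⟩
  have hsmall2 : ∀ᶠ c in 𝓝[>] (0 : ℝ), ∀ k k', FreeOverlap b k k' → ∀ v : G → ℝ,
      (∀ m, |v m| ≤ c) → ∃ θ θ', bandFunction b v k θ < bandFunction b v k' θ' := by
    rw [eventually_all]
    intro k
    rw [eventually_all]
    intro k'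
    by_cases h : FreeOverlap b k k'
    · obtain ⟨θ, θ', h⟩ := h
      filter_upwards [eventually_bandFunction_lt h] with c hc _ v hv
      exact ⟨θ, θ', hc v hv⟩
    · exact Eventually.of_forall fun c h' => absurd h' h
  obtain ⟨c, ⟨hc1, hc2⟩, hc0⟩ := ((hsmall1.and hsmall2).and self_mem_nhdsWithin).exists
  refine ⟨c, hc0, fun v hv => ?_⟩
  choose l r hlr using range_bandFunction b v
  have hmem : ∀ k θ, bandFunction b v k θ ∈ Set.Icc (l k) (r k) := fun k θ =>
    hlr k ▸ Set.mem_range_self θ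
  have hlr_lt : ∀ k, l k < r k := fun k => by
    obtain ⟨θ, θ', h⟩ := hc1 k v hv
    exact ((hmem k θ).1.trans_lt h).trans_le (hmem k θ').2
  have hanti_l : Antitone l := fun k k' hkk' => by
    obtain ⟨θ, hθ⟩ : l k ∈ Set.range (bandFunction b v k) :=
      hlr k ▸ Set.left_mem_Icc.2 (hlr_lt k).le
    rw [← hθ]
    exact (hmem k' θ).1.trans (bandFunction_antitone b v θ hkk')
  have hanti_r : Antitone r := fun k k' hkk' => by
    obtain ⟨θ, hθ⟩ : r k' ∈ Set.range (bandFunction b v k') :=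
      hlr k' ▸ Set.right_mem_Icc.2 (hlr_lt k').le
    rw [← hθ]
    exact (bandFunction_antitone b v θ hkk').trans (hmem k θ).2
  have hover : ∀ k k', FreeOverlap b k k' → l k ≤ r k' := fun k k' h => by
    obtain ⟨θ, θ', h⟩ := hc2 k k' h v hv
    exact (((hmem k θ).1.trans_lt h).trans_le (hmem k' θ').2).le
  have hcard : 0 < Fintype.card G := Fintype.card_pos
  let first : Fin (Fintype.card G) := ⟨0, hcard⟩
  let last : Fin (Fintype.card G) := ⟨Fintype.card G - 1, by omega⟩
  have hfirst : ∀ k, first ≤ k := fun k => Nat.zero_le (k : ℕ)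
  have hlast : ∀ k, k ≤ last := fun k => Nat.le_sub_one_of_lt k.2
  have hunion : ⋃ k, Set.range (bandFunction b v k) = ⋃ k, Set.Icc (l k) (r k) := by
    simp only [hlr]
  rw [hunion]
  have hsingle : (∀ k k' : Fin (Fintype.card G), (k' : ℕ) = k + 1 → FreeOverlap b k k') →
      ∃ a₁ b₁ : ℝ, a₁ < b₁ ∧ ⋃ k, Set.Icc (l k) (r k) = Set.Icc a₁ b₁ := fun hall => by
    refine ⟨l last, r first, (hanti_l (hfirst last)).trans_lt (hlr_lt first), ?_⟩
    rw [← biUnion_Icc_eq_of_overlap hanti_l hanti_r (hfirst last)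
      fun j j' hj _ _ => hover j j' (hall j j' hj)]
    simp [hfirst, hlast]
  constructor
  · by_cases hall : ∀ k k' : Fin (Fintype.card G), (k' : ℕ) = k + 1 → FreeOverlap b k k'
    · obtain ⟨a₁, b₁, hab, h⟩ := hsingle hall
      exact ⟨a₁, b₁, a₁, b₁, hab, hab, by rw [h, Set.union_self]⟩
    · push Not at hall
      obtain ⟨k, k', hk, hbad⟩ := hall
      have hgood : ∀ j j' : Fin (Fintype.card G), (j' : ℕ) = j + 1 → j ≠ k →
          FreeOverlap b j j' := fun j j' hj hjk => by
        by_contra hbad'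
        exact hjk (le_antisymm (le_of_not_freeOverlap hd hk hbad hj hbad')
          (le_of_not_freeOverlap hd hj hbad' hk hbad))
      -- The bands are cut at the unique bad pair; each side is a chain of overlapping intervals.
      refine ⟨l k, r first, l last, r k', (hanti_l (hfirst k)).trans_lt (hlr_lt first),
        (hanti_l (hlast k')).trans_lt (hlr_lt k'), ?_⟩
      rw [← biUnion_Icc_eq_of_overlap hanti_l hanti_r (hfirst k) fun j j' hj _ hjk =>
          hover j j' (hgood j j' hj (by
            rintro rfl
            rw [Fin.le_def] at hjk
            omega)),
        ← biUnion_Icc_eq_of_overlap hanti_l hanti_r (hlast k') fun j j' hj hjk _ =>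
          hover j j' (hgood j j' hj (by
            rintro rfl
            rw [Fin.le_def] at hjk
            omega)), ← Set.biUnion_union]
      have : Set.Icc first k ∪ Set.Icc k' last = Set.univ := by
        refine Set.eq_univ_of_forall fun j => ?_
        rcases le_or_gt j k with hj | hj
        · exact Or.inl ⟨hfirst j, hj⟩
        · exact Or.inr ⟨by rw [Fin.le_def, hk]; exact hj, hlast j⟩
      rw [this, Set.biUnion_univ]
  · rintro ⟨j, q, hq, hodd⟩
    refine hsingle fun k k' hk => ?_
    by_contra hbad
    exact (sign_of_not_freeOverlap hd hk hbad).2.2 j q hq hodd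

end bands

/-! ### Periodic potentials as functions on a finite group -/

section periodic

variable {d : ℕ}

/-- Coordinatewise reduction modulo the periods. -/
def reduction (q : Fin d → ℕ) : IntLattice d →+ ((i : Fin d) → ZMod (q i)) where
  toFun n i := (n i : ZMod (q i))
  map_zero' := by ext i; simp
  map_add' n m := by ext i; simp

theorem reduction_surjective (q : Fin d → ℕ) : Function.Surjective (reduction q) := fun g =>
  ⟨fun i => (ZMod.intCast_surjective (g i)).choose,
    funext fun i => (ZMod.intCast_surjective (g i)).choose_spec⟩

theorem nsmul_reduction_single (q : Fin d → ℕ) (j : Fin d) :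
    q j • reduction q (Pi.single j 1) = 0 := by
  rw [← map_nsmul]
  ext i
  by_cases h : i = j
  · subst h; simp [reduction]
  · simp [reduction, h]

/-- The periods of V form a subgroup containing the generators `q i` times the i-th basis vector,
hence the whole kernel of the reduction. -/
theorem IsPeriodicWith.eq_of_reduction_eq {q : Fin d → ℕ} {V : Potential d}
    (hV : IsPeriodicWith q V) {n m : IntLattice d} (h : reduction q n = reduction q m) :
    V n = V m := by
  let P : AddSubgroup (IntLattice d) :=
    { carrier := {p | ∀ n, V (n + p) = V n}
      zero_mem' := fun n => by rw [add_zero]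
      add_mem' := fun {a b} ha hb n => by rw [← add_assoc, hb, ha]
      neg_mem' := fun {a} ha n => by rw [← ha, neg_add_cancel_right] }
  have hgen : ∀ i, Pi.single i (q i : ℤ) ∈ P := fun i n => hV i n
  have hdvd : ∀ i, ∃ t, n i - m i = q i * t := fun i => by
    have : ((n i : ℤ) : ZMod (q i)) = (m i : ℤ) := congrFun h i
    exact (ZMod.intCast_eq_intCast_iff_dvd_sub _ _ _).1 this.symm
  choose t ht using hdvd
  have hsum : n - m = ∑ i, t i • Pi.single i (q i : ℤ) := by
    ext i
    rw [Finset.sum_apply, Finset.sum_eq_single i]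
    · simp [ht, mul_comm]
    · intro j _ hj
      simp [hj.symm]
    · simp
  have hmem : n - m ∈ P := hsum ▸ P.sum_mem fun i _ => P.zsmul_mem (hgen i) _
  have := hmem m
  rwa [add_sub_cancel] at this

theorem IsPeriodicWith.exists_eq_comp_reduction {q : Fin d → ℕ} {V : Potential d}
    (hV : IsPeriodicWith q V) : ∃ v : ((i : Fin d) → ZMod (q i)) → ℝ,
      (∀ n, V n = v (reduction q n)) ∧ ∀ g, |v g| ≤ ‖V‖ := by
  refine ⟨fun g => V (Function.surjInv (reduction_surjective q) g), fun n => ?_, fun g => ?_⟩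
  · exact hV.eq_of_reduction_eq (Function.surjInv_eq (reduction_surjective q) _).symm
  · exact lp.norm_apply_le_norm ENNReal.top_ne_zero V _

end periodic

end

theorem theorem1p1 (d : ℕ) (hd : 2 ≤ d) (q : Fin d → ℕ) (hq : ∀ i, 0 < q i) :
    ∃ c : ℝ, 0 < c ∧
      (∀ V : Potential d, IsPeriodicWith q V → ‖V‖ ≤ c →
        ∃ a₁ b₁ a₂ b₂ : ℝ, a₁ < b₁ ∧ a₂ < b₂ ∧
          spectrum ℂ (schrodinger V) =
            Complex.ofReal '' (Set.Icc a₁ b₁ ∪ Set.Icc a₂ b₂)) ∧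
      ((∃ i, Odd (q i)) →
        ∀ V : Potential d, IsPeriodicWith q V → ‖V‖ ≤ c →
          ∃ a b : ℝ, a < b ∧
            spectrum ℂ (schrodinger V) = Complex.ofReal '' Set.Icc a b) := by
  have : ∀ i, NeZero (q i) := fun i => ⟨(hq i).ne'⟩
  -- Only the group and the images of the basis vectors enter here, so c depends on d and q alone.
  obtain ⟨c, hc, h⟩ := exists_bands_union hd fun i => reduction q (Pi.single i 1)
  refine ⟨c, hc, fun V hV hVc => ?_, fun ⟨j, hj⟩ V hV hVc => ?_⟩
  · obtain ⟨v, hv, hvn⟩ := hV.exists_eq_comp_reduction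
    rw [spectrum_schrodinger (reduction_surjective q) hv]
    obtain ⟨a₁, b₁, a₂, b₂, h1, h2, h3⟩ := (h v fun g => (hvn g).trans hVc).1
    exact ⟨a₁, b₁, a₂, b₂, h1, h2, by rw [h3]⟩
  · obtain ⟨v, hv, hvn⟩ := hV.exists_eq_comp_reduction
    rw [spectrum_schrodinger (reduction_surjective q) hv]
    obtain ⟨a, b, h1, h2⟩ := (h v fun g => (hvn g).trans hVc).2
      ⟨j, q j, nsmul_reduction_single q j, hj⟩
    exact ⟨a, b, h1, by rw [h2]⟩
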